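/- Let $d\ge 1$ and $L>0$. For $\varepsilon\in\mathbf{R}$, a finite set $\Lambda\subset\mathbf{Z}^d$ and $x\in\mathbf{R}^{\mathbf{Z}^d}$ put $$H_\Lambda(x)=\frac12\sum_{i\in\Lambda}x_i^2-\frac{\varepsilon}{2d}\sum_{\substack{\{i,j\}:\ \|i-j\|_1=1,\\ \{i,j\}\cap\Lambda\ne\emptyset}}x_ix_j ,$$ each unordered pair $\{i,j\}$ being counted once. For $\xi\in[-L,L]^{\mathbf{Z}^d}$ let $\pi^{\varepsilon,L}_\Lambda(\cdot\mid\xi)$ be the probability measure on $[-L,L]^\Lambda$ whose density with respect to Lebesgue measure is $\frac{1}{Z^{\xi}_\Lambda}\exp(-H_\Lambda(x_\Lambda\xi_{\Lambda^c}))$, where $x_\Lambda\xi_{\Lambda^c}$ agrees with $x_\Lambda$ on $\Lambda$ and with $\xi$ outside $\Lambda$, and $Z^\xi_\Lambda$ is the normalising constant. A Gibbs measure of the truncated Gaussian model is a probability measure $\mu$ on $[-L,L]^{\mathbf{Z}^d}$ such that, for every finite $\Lambda$, the conditional law under $\mu$ of $X|_\Lambda$ given $(X_i)_{i\notin\Lambda}=(\xi_i)_{i\notin\Lambda}$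 is $\pi^{\varepsilon,L}_\Lambda(\cdot\mid\xi)$ for $\mu$-a.e. $\xi$. There is $\varepsilon_0>0$ (depending on $d$ and $L$) such that for every $\varepsilon$ with $|\varepsilon|<\varepsilon_0$ there is exactly one such Gibbs measure $\mu^L_\varepsilon$, and: 1. $\mu^L_\varepsilon$ is a finitary factor of an i.i.d. process, with exponential tails. That is, there are a probability space $(\mathcal{Y},\mathcal{F},\nu)$ and a measurable map $F:\mathcal{Y}^{\mathbf{Z}^d}\to[-L,L]^{\mathbf{Z}^d}$, commuting with all translations of $\mathbf{Z}^d$, such that $\mu^L_\varepsilon$ is the image of $\nu^{\otimes\mathbf{Z}^d}$ under $F$, and such that the coding radius $$R(y)=\inf\{r\ge 0:\ \forall y'\in\mathcal{Y}^{\mathbf{Z}^d},\ (y'_j=y_j \text{ whenever } \|j\|_1\le r)\implies F(y')_0=F(y)_0\}$$ is $\nu^{\otimes\mathbf{Z}^d}$-almost surely finite and satisfies, for some constants $C,c>0$, $\mathbf{P}(R\ge n)\le Ce^{-cn}$ for all $n\in\mathbf{N}$, where $\mathbf{P}=\nu^{\otimes\mathbf{Z}^d}$. 2. There is $c>0$ such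 that for every $l\in\mathbf{N}$ there is an $l$-dependent probability measure $\nu_l$ on $[-L,L]^{\mathbf{Z}^d}$ (i.e. for all $A,B\subset\mathbf{Z}^d$ at $\ell^1$ distance greater than $l$, the restrictions to $A$ and to $B$ of a field of law $\nu_l$ are independent) such that for every finite $\Lambda\subset\mathbf{Z}^d$ $$d_{\mathrm{TV}}(\mu^L_\varepsilon|_\Lambda,\nu_l|_\Lambda)\le|\Lambda|\,e^{-cl},$$ where $\mu|_\Lambda$ denotes the marginal of $\mu$ on $[-L,L]^\Lambda$ and $d_{\mathrm{TV}}(\mu,\nu)=\sup_A|\mu(A)-\nu(A)|$, the supremum being over measurable sets. -/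

import Mathlib

open MeasureTheory ProbabilityTheory

noncomputable section

/-- The lattice `ℤ^d`. -/
abbrev Site (d : ℕ) : Type := Fin d → ℤ

/-- The `ℓ¹` distance on `ℤ^d`. -/
def latticeDist {d : ℕ} (i j : Site d) : ℕ := ∑ k, (i k - j k).natAbs

/-- The configuration `(x_{k+i})_i`, i.e. `x` translated by `k`. -/
def shiftConfig {d : ℕ} {S : Type*} (k : Site d) (x : Site d → S) : Site d → S :=
  fun i => x (k + i)

/-! ### Factors of i.i.d. processes -/

/-- `F` is a coding from the product measure `ν^{⊗ ℤ^d}` to `μ`: it is measurable, commutes with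
all the translations, and sends `ν^{⊗ ℤ^d}` to `μ`. -/
structure IsCoding {d : ℕ} {S Y : Type*} [MeasurableSpace S] [MeasurableSpace Y]
    (ν : Measure Y) [IsProbabilityMeasure ν] (μ : Measure (Site d → S))
    (F : (Site d → Y) → (Site d → S)) : Prop where
  measurable : Measurable F
  commutes : ∀ (k : Site d) (y : Site d → Y), F (shiftConfig k y) = shiftConfig k (F y)
  map_eq : (Measure.infinitePi fun _ : Site d => ν).map F = μ

/-- The coding radius of `F` at the site `i` and the configuration `y`: the least `r` such that
`F(y)_i` is determined by `y` on the `ℓ¹` ball of radius `r` around `i`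
(`⊤` if there is no such `r`). -/
def codingRadius {d : ℕ} {S Y : Type*} (F : (Site d → Y) → (Site d → S))
    (i : Site d) (y : Site d → Y) : ℕ∞ :=
  ⨅ (r : ℕ) (_ : ∀ y' : Site d → Y, (∀ j, latticeDist j i ≤ r → y' j = y j) → F y i = F y' i),
    (r : ℕ∞)

/-- `μ` is a finitary factor of an i.i.d. process, with exponential tails for the coding radius. -/
def IsFFIIDWithExpTails {d : ℕ} {S : Type*} [MeasurableSpace S]
    (μ : Measure (Site d → S)) : Prop :=
  ∃ (Y : Type) (_ : MeasurableSpace Y) (ν : Measure Y) (_ : IsProbabilityMeasure ν)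
    (F : (Site d → Y) → (Site d → S)),
    IsCoding ν μ F ∧
    (∀ᵐ y ∂(Measure.infinitePi fun _ : Site d => ν), codingRadius F 0 y ≠ ⊤) ∧
    ∃ C : ℝ, 0 < C ∧ ∃ c : ℝ, 0 < c ∧ ∀ n : ℕ,
      (Measure.infinitePi fun _ : Site d => ν) {y | (n : ℕ∞) ≤ codingRadius F 0 y} ≤
        ENNReal.ofReal (C * Real.exp (-c * n))

/-! ### Finite dependence and total variation -/

/-- `μ` is `l`-dependent: the restrictions of the field to two sets of sites at `ℓ¹` distance
greater than `l` are independent. -/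
def IsDependentOfRange {d : ℕ} {S : Type*} [MeasurableSpace S] (l : ℕ)
    (μ : Measure (Site d → S)) : Prop :=
  ∀ A B : Set (Site d), (∀ a ∈ A, ∀ b ∈ B, l < latticeDist a b) →
    IndepFun (fun x : Site d → S => A.domRestrict x) (fun x : Site d → S => B.domRestrict x) μ

/-- The total variation distance `sup_A |μ(A) - ν(A)|` of two probability measures. -/
def tvDistance {X : Type*} [MeasurableSpace X] (μ ν : Measure X) : ℝ :=
  ⨆ A : {A : Set X // MeasurableSet A}, |μ.real A - ν.real A|

/-- The marginal of `μ` on the finite set `Λ` of sites. -/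
def marginal {d : ℕ} {S : Type*} [MeasurableSpace S] (μ : Measure (Site d → S))
    (Λ : Finset (Site d)) : Measure (Λ → S) :=
  μ.map fun x => Λ.restrict x

/-! ### The truncated Gaussian model -/

/-- The Hamiltonian
`H_Λ(x) = 1/2 ∑_{i ∈ Λ} x_i² - ε/(2d) ∑_{i ∼ j, {i,j} ∩ Λ ≠ ∅} x_i x_j`,
where each unordered pair of nearest neighbours is counted once. Such a pair is `{i, i + e_k}` for
exactly one site `i` and one `k`, with `e_k = Pi.single k 1`, and it meets `Λ` if and only if
`i ∈ Λ` or `i ∈ Λ - e_k`. -/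
def hamiltonian {d : ℕ} (ε : ℝ) (Λ : Finset (Site d)) (x : Site d → ℝ) : ℝ :=
  1 / 2 * ∑ i ∈ Λ, x i ^ 2 -
    ε / (2 * d) * ∑ k : Fin d, ∑ i ∈ Λ ∪ Λ.image (fun j => j - Pi.single k 1),
      x i * x (i + Pi.single k 1)

/-- The configuration that agrees with `x` on `Λ` and with `ξ` outside `Λ`. -/
def glue {d : ℕ} {S : Type*} (Λ : Finset (Site d)) (x : Λ → S) (ξ : Site d → S) :
    Site d → S :=
  fun i => if h : i ∈ Λ then x ⟨i, h⟩ else ξ i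

/-- The specification of the Gaussian model truncated to `[-L, L]`: the probability measure on
`[-L, L]^Λ` with density `exp (-H_Λ(x_Λ ξ_{Λᶜ})) / Z` with respect to Lebesgue measure, where `Z`
is the normalising constant. -/
def truncatedSpec {d : ℕ} (ε L : ℝ) (Λ : Finset (Site d))
    (ξ : Site d → Set.Icc (-L) L) : Measure (Λ → Set.Icc (-L) L) :=
  (Measure.pi fun _ : Λ => (volume : Measure ℝ).comap (Subtype.val : Set.Icc (-L) L → ℝ)).tilted
    fun x => -hamiltonian ε Λ fun i => (glue Λ x ξ i).1

/-- `μ` is a Gibbs measure of the truncated Gaussian model (DLR equations): for every finite `Λ`,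
the conditional law of the field on `Λ` given the field outside `Λ` is the specification. -/
structure IsTruncatedGibbs {d : ℕ} (ε L : ℝ) (μ : Measure (Site d → Set.Icc (-L) L)) :
    Prop where
  isProbabilityMeasure : IsProbabilityMeasure μ
  dlr : ∀ (Λ : Finset (Site d)) (A : Set (Λ → Set.Icc (-L) L)), MeasurableSet A →
    μ⟦{x | Λ.restrict x ∈ A} | cylinderEvents (X := fun _ : Site d => Set.Icc (-L) L)
      ((Λ : Set (Site d))ᶜ)⟧ =ᵐ[μ] fun ξ => (truncatedSpec ε L Λ ξ).real A

end

/-! Every Gibbs measure is stationary, in each finite box, for a parallel Glauber dynamics. For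
small `ε` this dynamics forgets its past exponentially fast, and coupling from the past turns it
into a coding.

At each time every site tosses a fair coin and is active if it shows `true` while its neighbours
show `false`; so no two active sites are adjacent. An active site proposes a spin `z` with the `ε =
0` law and accepts it if a uniform variable is at most `exp (h z - |ε| L²)`, where `h` is the field
of its neighbours; after a rejection the old spin stays. Accepted proposals follow the conditional
Gibbs law, so a law invariant under single-site resampling is preserved
(`IsSpecInvariant.lintegral_siteUpdate`, `lintegral_sweep`).

Since `|h z| ≤ |ε| L²`, the acceptance probability is at least `exp (-2 |ε| L²)`. When the uniform
variable is below this value, an active site takes the proposed spin whatever surrounds it, and its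
past is forgotten. Traced backwards in time, the dependence is dominated by a branching process of
mean offspring `ρ = 1 - 2^{-(2d+1)} + (2d+1)(1 - exp (-2 |ε| L²))`, and `ρ < 1` for small `ε`. Hence
`Alive` holds at depth `n` with probability at most `ρ^n` (`measure_alive_le`). Once it fails at
depth `n`, the spin is a function of the seeds within distance `n`; this gives `pastCoding` and its
exponential tails.

The comparison `lintegral_compare` says that a law invariant under the single-site resamplings in a
box containing the `n`-neighbourhood of `Δ` agrees on `Δ` with the law of the coding up to `|Δ|
ρ^n`. For a Gibbs measure this yields uniqueness; for finite-volume Gibbs laws it yields the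
invariance of the law of the coding, hence existence without compactness.

For the second assertion the coding is made to read only the seeds within distance `l / 2`. The
result is `l`-dependent and differs from the original at a given site with exponentially small
probability. The prefactor is absorbed by lowering the rate, and the finitely many small `l` are
served by a product measure. -/

noncomputable section

/-! ### The specification -/

/-- The single spin space `[-L, L]`. -/
abbrev Spin (L : ℝ) : Type := Set.Icc (-L) L

/-- Lebesgue measure on the single spin space. -/
def spinVolume (L : ℝ) : Measure (Spin L) := (volume : Measure ℝ).comap Subtype.val

instance (L : ℝ) : IsFiniteMeasure (spinVolume L) := by
  refine ⟨?_⟩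
  rw [spinVolume, comap_subtype_coe_apply measurableSet_Icc, Set.image_univ, Subtype.range_coe]
  exact measure_Icc_lt_top

theorem spinVolume_ne_zero {L : ℝ} (hL : 0 < L) : NeZero (spinVolume L) := by
  refine ⟨fun h => ?_⟩
  have h1 : spinVolume L Set.univ = 0 := by simp [h]
  rw [spinVolume, comap_subtype_coe_apply measurableSet_Icc, Set.image_univ, Subtype.range_coe,
    Real.volume_Icc, ENNReal.ofReal_eq_zero] at h1
  linarith

theorem pi_spinVolume_ne_zero {L : ℝ} (hL : 0 < L) (ι : Type*) [Fintype ι] :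
    NeZero (Measure.pi fun _ : ι => spinVolume L) := by
  have := spinVolume_ne_zero hL
  refine ⟨fun h => ?_⟩
  have h1 : (Measure.pi fun _ : ι => spinVolume L) Set.univ = 0 := by simp [h]
  rw [Measure.pi_univ, Finset.prod_eq_zero_iff] at h1
  obtain ⟨_, -, h2⟩ := h1
  exact NeZero.ne _ (Measure.measure_univ_eq_zero.1 h2)

/-- The field seen by the spin at `i`. -/
def localField {d : ℕ} {L : ℝ} (ε : ℝ) (i : Site d) (x : Site d → Spin L) : ℝ :=
  ε / (2 * d) * ∑ k : Fin d, ((x (i + Pi.single k 1)).1 + (x (i - Pi.single k 1)).1)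

/-- The Boltzmann weight `exp (-H_Λ(x))`. -/
def boltzmann {d : ℕ} {L : ℝ} (ε : ℝ) (Λ : Finset (Site d)) (x : Site d → Spin L) : ENNReal :=
  ENNReal.ofReal (Real.exp (-hamiltonian ε Λ fun i => (x i).1))

/-- The integral of `f` over the spins in `Λ` with respect to the Boltzmann weight. -/
def weightedIntegral {d : ℕ} {L : ℝ} (ε : ℝ) (Λ : Finset (Site d))
    (f : (Site d → Spin L) → ENNReal) : (Site d → Spin L) → ENNReal :=
  lmarginal (fun _ => spinVolume L) Λ fun x => boltzmann ε Λ x * f x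

/-- The integral of `f` with respect to the specification on `Λ`. -/
def specIntegral {d : ℕ} {L : ℝ} (ε : ℝ) (Λ : Finset (Site d))
    (f : (Site d → Spin L) → ENNReal) (ξ : Site d → Spin L) : ENNReal :=
  weightedIntegral ε Λ f ξ / weightedIntegral ε Λ 1 ξ

section
variable {d : ℕ} {L : ℝ} {ε : ℝ}

theorem measurable_hamiltonian (Λ : Finset (Site d)) :
    Measurable fun x : Site d → Spin L => hamiltonian ε Λ fun i => (x i).1 := by
  unfold hamiltonian
  fun_prop

theorem measurable_boltzmann (Λ : Finset (Site d)) :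
    Measurable (boltzmann (L := L) ε Λ) := by
  unfold boltzmann
  have := measurable_hamiltonian (L := L) (ε := ε) Λ
  fun_prop

theorem measurable_weightedIntegral (Λ : Finset (Site d)) {f : (Site d → Spin L) → ENNReal}
    (hf : Measurable f) : Measurable (weightedIntegral ε Λ f) :=
  ((measurable_boltzmann Λ).mul hf).lmarginal _

theorem measurable_specIntegral (Λ : Finset (Site d)) {f : (Site d → Spin L) → ENNReal}
    (hf : Measurable f) : Measurable (specIntegral ε Λ f) :=
  (measurable_weightedIntegral Λ hf).div (measurable_weightedIntegral Λ measurable_one)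

theorem glue_eq_updateFinset (Λ : Finset (Site d)) (x : Λ → Spin L) (ξ : Site d → Spin L) :
    glue Λ x ξ = Function.updateFinset ξ Λ x := rfl

theorem measurable_glue (Λ : Finset (Site d)) (ξ : Site d → Spin L) :
    Measurable fun x => glue Λ x ξ :=
  measurable_updateFinset (s := Λ) (x := ξ)

theorem exists_abs_hamiltonian_le (Λ : Finset (Site d)) :
    ∃ C, ∀ x : Site d → Spin L, |hamiltonian ε Λ fun i => (x i).1| ≤ C := by
  have hx : ∀ s : Spin L, |s.1| ≤ L := fun s => abs_le.2 s.2
  refine ⟨1 / 2 * ∑ i ∈ Λ, L ^ 2 + |ε / (2 * d)| * ∑ k : Fin d,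
    ∑ i ∈ Λ ∪ Λ.image (fun j => j - Pi.single k 1), L * L, fun x => ?_⟩
  unfold hamiltonian
  refine (abs_sub _ _).trans ?_
  rw [abs_mul, abs_mul]
  gcongr
  · norm_num
  · refine (Finset.abs_sum_le_sum_abs _ _).trans (Finset.sum_le_sum fun i _ => ?_)
    rw [abs_pow]
    exact pow_le_pow_left₀ (abs_nonneg _) (hx _) 2
  · refine (Finset.abs_sum_le_sum_abs _ _).trans (Finset.sum_le_sum fun k _ => ?_)
    refine (Finset.abs_sum_le_sum_abs _ _).trans (Finset.sum_le_sum fun i _ => ?_)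
    rw [abs_mul]
    exact mul_le_mul (hx _) (hx _) (abs_nonneg _) ((abs_nonneg _).trans (hx (x i)))

theorem integrable_exp_neg_hamiltonian (Λ : Finset (Site d)) (ξ : Site d → Spin L) :
    Integrable (fun x => Real.exp (-hamiltonian ε Λ fun i => (glue Λ x ξ i).1))
      (Measure.pi fun _ : Λ => spinVolume L) := by
  obtain ⟨C, hC⟩ := exists_abs_hamiltonian_le (L := L) (ε := ε) Λ
  refine Integrable.of_bound (C := Real.exp C) ?_ ?_
  · have h1 := (measurable_hamiltonian (L := L) (ε := ε) Λ).comp (measurable_glue Λ ξ)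
    exact (Real.measurable_exp.comp h1.neg).aestronglyMeasurable
  · refine Filter.Eventually.of_forall fun x => ?_
    rw [Real.norm_eq_abs, Real.abs_exp]
    exact Real.exp_le_exp.2 ((neg_le_abs _).trans (hC _))

theorem isProbabilityMeasure_truncatedSpec (hL : 0 < L) (Λ : Finset (Site d))
    (ξ : Site d → Spin L) : IsProbabilityMeasure (truncatedSpec ε L Λ ξ) := by
  have : NeZero (Measure.pi fun _ : Λ => (volume : Measure ℝ).comap
      (Subtype.val : Set.Icc (-L) L → ℝ)) := pi_spinVolume_ne_zero hL Λ
  exact isProbabilityMeasure_tilted (integrable_exp_neg_hamiltonian Λ ξ)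

theorem weightedIntegral_one (Λ : Finset (Site d)) (ξ : Site d → Spin L) :
    weightedIntegral ε Λ 1 ξ = ENNReal.ofReal
      (∫ x, Real.exp (-hamiltonian ε Λ fun i => (glue Λ x ξ i).1)
        ∂Measure.pi fun _ : Λ => spinVolume L) := by
  rw [ofReal_integral_eq_lintegral_ofReal (integrable_exp_neg_hamiltonian Λ ξ)
    (Filter.Eventually.of_forall fun x => (Real.exp_pos _).le)]
  simp [weightedIntegral, lmarginal, boltzmann, glue_eq_updateFinset]

theorem weightedIntegral_one_ne_top (Λ : Finset (Site d)) (ξ : Site d → Spin L) :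
    weightedIntegral ε Λ 1 ξ ≠ ⊤ := by
  simp [weightedIntegral_one]

theorem weightedIntegral_one_ne_zero (hL : 0 < L) (Λ : Finset (Site d)) (ξ : Site d → Spin L) :
    weightedIntegral ε Λ 1 ξ ≠ 0 := by
  have := pi_spinVolume_ne_zero hL Λ
  rw [weightedIntegral_one, Ne, ENNReal.ofReal_eq_zero, not_le]
  exact integral_exp_pos (integrable_exp_neg_hamiltonian Λ ξ)

theorem lintegral_truncatedSpec (hL : 0 < L) (Λ : Finset (Site d)) (ξ : Site d → Spin L)
    {f : (Site d → Spin L) → ENNReal} (hf : Measurable f) :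
    ∫⁻ x, f (glue Λ x ξ) ∂truncatedSpec ε L Λ ξ = specIntegral ε Λ f ξ := by
  have := pi_spinVolume_ne_zero hL Λ
  have hpos := integral_exp_pos (integrable_exp_neg_hamiltonian (ε := ε) Λ ξ)
  have hm : Measurable fun x => boltzmann ε Λ (glue Λ x ξ) * f (glue Λ x ξ) :=
    ((measurable_boltzmann Λ).mul hf).comp (measurable_glue Λ ξ)
  rw [truncatedSpec, lintegral_tilted, specIntegral, weightedIntegral_one, ENNReal.div_eq_inv_mul]
  change _ = _ * ∫⁻ x, boltzmann ε Λ (glue Λ x ξ) * f (glue Λ x ξ)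
    ∂Measure.pi fun _ : Λ => spinVolume L
  rw [← lintegral_const_mul _ hm]
  refine lintegral_congr fun x => ?_
  rw [← mul_assoc]
  congr 1
  rw [← spinVolume, ENNReal.ofReal_div_of_pos hpos, ENNReal.div_eq_inv_mul]
  rfl

theorem weightedIntegral_congr_ext (Λ : Finset (Site d)) (f : (Site d → Spin L) → ENNReal)
    {ξ η : Site d → Spin L} (h : ∀ i ∉ Λ, ξ i = η i) :
    weightedIntegral ε Λ f ξ = weightedIntegral ε Λ f η :=
  lmarginal_congr _ _ h

theorem specIntegral_congr_ext (Λ : Finset (Site d)) (f : (Site d → Spin L) → ENNReal)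
    {ξ η : Site d → Spin L} (h : ∀ i ∉ Λ, ξ i = η i) :
    specIntegral ε Λ f ξ = specIntegral ε Λ f η := by
  simp only [specIntegral, weightedIntegral_congr_ext Λ _ h]

theorem lmarginal_mul_left (Λ : Finset (Site d)) {g f : (Site d → Spin L) → ENNReal}
    (hf : Measurable f)
    (hg : ∀ ξ η : Site d → Spin L, (∀ i ∉ Λ, ξ i = η i) → g ξ = g η) (ξ : Site d → Spin L) :
    lmarginal (fun _ => spinVolume L) Λ (fun x => g x * f x) ξ =
      g ξ * lmarginal (fun _ => spinVolume L) Λ f ξ := by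
  unfold lmarginal
  have hm : Measurable fun y : Λ → Spin L => f (Function.updateFinset ξ Λ y) :=
    hf.comp measurable_updateFinset
  refine Eq.trans ?_ (lintegral_const_mul _ hm)
  refine lintegral_congr fun x => ?_
  change g _ * f _ = _
  rw [hg (Function.updateFinset ξ Λ x) ξ fun i hi => by simp [Function.updateFinset, hi]]

theorem weightedIntegral_mul_left (Λ : Finset (Site d)) {g f : (Site d → Spin L) → ENNReal}
    (hf : Measurable f)
    (hg : ∀ ξ η : Site d → Spin L, (∀ i ∉ Λ, ξ i = η i) → g ξ = g η) (ξ : Site d → Spin L) :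
    weightedIntegral ε Λ (fun x => g x * f x) ξ = g ξ * weightedIntegral ε Λ f ξ := by
  refine Eq.trans ?_ (lmarginal_mul_left Λ ((measurable_boltzmann (ε := ε) Λ).mul hf) hg ξ)
  rw [weightedIntegral]
  congr 1
  ext x
  rw [mul_left_comm]
  rfl

theorem specIntegral_mul_left (Λ : Finset (Site d)) {g f : (Site d → Spin L) → ENNReal}
    (hf : Measurable f)
    (hg : ∀ ξ η : Site d → Spin L, (∀ i ∉ Λ, ξ i = η i) → g ξ = g η) (ξ : Site d → Spin L) :
    specIntegral ε Λ (fun x => g x * f x) ξ = g ξ * specIntegral ε Λ f ξ := by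
  rw [specIntegral, weightedIntegral_mul_left Λ hf hg, mul_div_assoc, specIntegral]

/-- `specIntegral ε Λ f` does not depend on the spins in `Λ`, so it leaves the integral and the
normalising constant cancels. -/
theorem weightedIntegral_specIntegral (hL : 0 < L) (Λ : Finset (Site d))
    (f : (Site d → Spin L) → ENNReal) (ξ : Site d → Spin L) :
    weightedIntegral ε Λ (specIntegral ε Λ f) ξ = weightedIntegral ε Λ f ξ := by
  have := weightedIntegral_mul_left (ε := ε) Λ (g := specIntegral ε Λ f) (f := 1) measurable_one
    (fun ξ η h => specIntegral_congr_ext Λ f h) ξ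
  simp only [Pi.one_apply, mul_one] at this
  refine this.trans ?_
  rw [specIntegral, ENNReal.div_mul_cancel (weightedIntegral_one_ne_zero hL Λ ξ)
    (weightedIntegral_one_ne_top Λ ξ)]

/-- The energy difference `H_V - H_Λ` does not depend on the spins in `Λ ⊆ V`. -/
theorem hamiltonian_sub_congr {Λ V : Finset (Site d)} (h : Λ ⊆ V) {x y : Site d → ℝ}
    (hxy : ∀ i ∉ Λ, x i = y i) :
    hamiltonian ε V x - hamiltonian ε Λ x = hamiltonian ε V y - hamiltonian ε Λ y := by
  -- What remains of the difference are the sites of `V \ Λ` and the bonds that do not touch `Λ`.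
  have key : ∀ x : Site d → ℝ, hamiltonian ε V x - hamiltonian ε Λ x =
      1 / 2 * ∑ i ∈ V \ Λ, x i ^ 2 - ε / (2 * d) * ∑ k : Fin d,
        ∑ i ∈ (V ∪ V.image (fun j => j - Pi.single k 1)) \
          (Λ ∪ Λ.image (fun j => j - Pi.single k 1)), x i * x (i + Pi.single k 1) := by
    intro x
    have h2 : ∀ k : Fin d, ∑ i ∈ (V ∪ V.image (fun j => j - Pi.single k 1)) \
          (Λ ∪ Λ.image (fun j => j - Pi.single k 1)), x i * x (i + Pi.single k 1) =
        ∑ i ∈ V ∪ V.image (fun j => j - Pi.single k 1), x i * x (i + Pi.single k 1) -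
        ∑ i ∈ Λ ∪ Λ.image (fun j => j - Pi.single k 1), x i * x (i + Pi.single k 1) := fun k =>
      eq_sub_of_add_eq
        (Finset.sum_sdiff (Finset.union_subset_union h (Finset.image_subset_image h)))
    simp only [h2, Finset.sum_sub_distrib]
    have h3 := Finset.sum_sdiff h (f := fun i => x i ^ 2)
    rw [show ∑ i ∈ V \ Λ, x i ^ 2 = ∑ i ∈ V, x i ^ 2 - ∑ i ∈ Λ, x i ^ 2 by linarith]
    unfold hamiltonian
    ring
  rw [key, key]
  congr 2
  · refine Finset.sum_congr rfl fun i hi => ?_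
    rw [hxy i (Finset.mem_sdiff.1 hi).2]
  · refine Finset.sum_congr rfl fun k _ => Finset.sum_congr rfl fun i hi => ?_
    simp only [Finset.mem_sdiff, Finset.mem_union, Finset.mem_image, not_or, not_exists,
      not_and] at hi
    rw [hxy i hi.2.1, hxy (i + Pi.single k 1) fun hmem => hi.2.2 _ hmem (by simp)]

/-- The factor `exp (-(H_V - H_Λ))` is constant in the spins of `Λ`, so these can be integrated
first, with their own weight. -/
theorem weightedIntegral_of_subset {Λ V : Finset (Site d)} (h : Λ ⊆ V)
    {f : (Site d → Spin L) → ENNReal} (hf : Measurable f) :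
    weightedIntegral ε V f = lmarginal (fun _ => spinVolume L) (V \ Λ) fun x =>
      ENNReal.ofReal (Real.exp (-(hamiltonian ε V (fun i => (x i).1) -
        hamiltonian ε Λ fun i => (x i).1))) * weightedIntegral ε Λ f x := by
  conv_lhs => rw [weightedIntegral, ← Finset.sdiff_union_of_subset h]
  rw [lmarginal_union _ _ (by
    rw [Finset.sdiff_union_of_subset h]
    exact (measurable_boltzmann V).mul hf) Finset.sdiff_disjoint]
  congr 1
  ext x
  refine Eq.trans ?_ (lmarginal_mul_left Λ ((measurable_boltzmann (ε := ε) Λ).mul hf)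
    (g := fun x => ENNReal.ofReal (Real.exp (-(hamiltonian ε V (fun i => (x i).1) -
        hamiltonian ε Λ fun i => (x i).1))))
    (fun ξ η hξ => by
      simp only [hamiltonian_sub_congr (ε := ε) h (x := fun i => (ξ i).1) (y := fun i => (η i).1)
        fun i hi => by rw [hξ i hi]]) x)
  congr 1
  ext y
  rw [Finset.sdiff_union_of_subset h, Pi.mul_apply, ← mul_assoc, boltzmann, boltzmann,
    ← ENNReal.ofReal_mul (Real.exp_pos _).le, ← Real.exp_add]
  congr 4
  ring

/-- Consistency of the specification: after integrating over `Λ` first, `f` and its average over `Λ`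
have the same weighted integral. -/
theorem specIntegral_specIntegral (hL : 0 < L) {Λ V : Finset (Site d)} (h : Λ ⊆ V)
    {f : (Site d → Spin L) → ENNReal} (hf : Measurable f) :
    specIntegral ε V (specIntegral ε Λ f) = specIntegral ε V f := by
  ext ξ
  rw [specIntegral, specIntegral, weightedIntegral_of_subset h (measurable_specIntegral Λ hf),
    weightedIntegral_of_subset h hf]
  simp only [weightedIntegral_specIntegral hL]

theorem hamiltonian_singleton_update (i : Site d) (x : Site d → Spin L) (z : Spin L) :
    hamiltonian ε {i} (fun j => (Function.update x i z j).1) =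
      z.1 ^ 2 / 2 - localField ε i x * z.1 := by
  have hne : ∀ k : Fin d, (Pi.single k 1 : Site d) ≠ 0 := fun k => by simp
  have h1 : ∀ k : Fin d, ∑ j ∈ ({i} : Finset (Site d)) ∪
      ({i} : Finset (Site d)).image (fun j => j - Pi.single k 1),
      (Function.update x i z j).1 * (Function.update x i z (j + Pi.single k 1)).1 =
      ((x (i + Pi.single k 1)).1 + (x (i - Pi.single k 1)).1) * z.1 := by
    intro k
    have h2 : i - Pi.single k 1 ≠ i := by simp
    -- The indices `i` and `i - e_k` stand for the two distinct bonds at `i` in direction `k`.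
    rw [Finset.image_singleton, Finset.sum_union (by simpa using h2.symm)]
    simp [hne k]
    ring
  rw [hamiltonian, localField]
  simp only [h1, ← Finset.sum_mul]
  simp
  ring

/-- Each of the `2d` neighbours contributes at most `L`, and the factor `1 / (2d)` compensates their
number. This bounds the acceptance probability from both sides. -/
theorem abs_localField_mul_le (i : Site d) (x : Site d → Spin L) (z : Spin L) :
    |localField ε i x * z.1| ≤ |ε| * L ^ 2 := by
  have hx : ∀ s : Spin L, |s.1| ≤ L := fun s => abs_le.2 s.2
  have hL : 0 ≤ L := (abs_nonneg _).trans (hx z)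
  have h1 : |localField ε i x| ≤ |ε| * L := by
    have h2 : |∑ k : Fin d, ((x (i + Pi.single k 1)).1 + (x (i - Pi.single k 1)).1)| ≤
        d * (2 * L) := by
      refine (Finset.abs_sum_le_sum_abs _ _).trans ?_
      refine (Finset.sum_le_sum fun k _ =>
        (abs_add_le _ _).trans (add_le_add (hx _) (hx _))).trans ?_
      simp [two_mul, mul_add]
    rw [localField, abs_mul, abs_div]
    rcases Nat.eq_zero_or_pos d with rfl | hd
    · simp; positivity
    · have hd' : (0 : ℝ) < d := by exact_mod_cast hd
      rw [abs_of_pos (by positivity : (0 : ℝ) < 2 * d)]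
      calc |ε| / (2 * d) * _ ≤ |ε| / (2 * d) * (d * (2 * L)) := by gcongr
        _ = |ε| * L := by field_simp
  rw [abs_mul]
  calc |localField ε i x| * |z.1| ≤ |ε| * L * L := by gcongr; exact hx z
    _ = |ε| * L ^ 2 := by ring

end

/-! ### The DLR equations as an invariance -/

/-- The law on the full lattice of the field that is resampled in `Λ` and equals `ξ` outside. -/
def gibbsKernel {d : ℕ} {L : ℝ} (ε : ℝ) (Λ : Finset (Site d)) (ξ : Site d → Spin L) :
    Measure (Site d → Spin L) :=
  (truncatedSpec ε L Λ ξ).map fun x => glue Λ x ξ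

/-- Resampling the spins in `Λ` preserves `μ`. -/
def IsSpecInvariant {d : ℕ} {L : ℝ} (ε : ℝ) (Λ : Finset (Site d))
    (μ : Measure (Site d → Spin L)) : Prop :=
  μ.bind (gibbsKernel ε Λ) = μ

section
variable {d : ℕ} {L : ℝ} {ε : ℝ}

theorem isProbabilityMeasure_gibbsKernel (hL : 0 < L) (Λ : Finset (Site d))
    (ξ : Site d → Spin L) : IsProbabilityMeasure (gibbsKernel ε Λ ξ) := by
  have := isProbabilityMeasure_truncatedSpec (ε := ε) hL Λ ξ
  exact Measure.isProbabilityMeasure_map (measurable_glue Λ ξ).aemeasurable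

theorem lintegral_gibbsKernel (hL : 0 < L) (Λ : Finset (Site d)) (ξ : Site d → Spin L)
    {f : (Site d → Spin L) → ENNReal} (hf : Measurable f) :
    ∫⁻ x, f x ∂gibbsKernel ε Λ ξ = specIntegral ε Λ f ξ := by
  rw [gibbsKernel, lintegral_map hf (measurable_glue Λ ξ), lintegral_truncatedSpec hL Λ ξ hf]

theorem gibbsKernel_apply (hL : 0 < L) (Λ : Finset (Site d)) (ξ : Site d → Spin L)
    {s : Set (Site d → Spin L)} (hs : MeasurableSet s) :
    gibbsKernel ε Λ ξ s = specIntegral ε Λ (s.indicator 1) ξ := by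
  rw [← lintegral_gibbsKernel hL Λ ξ (measurable_one.indicator hs), lintegral_indicator_one hs]

theorem measurable_gibbsKernel (hL : 0 < L) (Λ : Finset (Site d)) :
    Measurable (gibbsKernel (L := L) ε Λ) := by
  refine Measure.measurable_of_measurable_coe _ fun s hs => ?_
  simp only [gibbsKernel_apply hL Λ _ hs]
  exact measurable_specIntegral Λ (measurable_one.indicator hs)

theorem IsSpecInvariant.lintegral_specIntegral (hL : 0 < L) {Λ : Finset (Site d)}
    {μ : Measure (Site d → Spin L)} (h : IsSpecInvariant ε Λ μ)
    {f : (Site d → Spin L) → ENNReal} (hf : Measurable f) :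
    ∫⁻ ξ, specIntegral ε Λ f ξ ∂μ = ∫⁻ ξ, f ξ ∂μ := by
  conv_rhs => rw [← h, Measure.lintegral_bind (measurable_gibbsKernel hL Λ).aemeasurable
    hf.aemeasurable]
  simp only [lintegral_gibbsKernel hL Λ _ hf]

/-- Consistency in kernel form. It supplies invariant laws in every finite box, before any
infinite-volume Gibbs measure is known to exist. -/
theorem isSpecInvariant_gibbsKernel (hL : 0 < L) {Λ V : Finset (Site d)} (h : Λ ⊆ V)
    (ξ : Site d → Spin L) : IsSpecInvariant ε Λ (gibbsKernel ε V ξ) := by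
  refine Measure.ext fun s hs => ?_
  rw [Measure.bind_apply hs (measurable_gibbsKernel hL Λ).aemeasurable]
  simp only [gibbsKernel_apply hL _ _ hs]
  rw [lintegral_gibbsKernel hL V ξ (measurable_specIntegral Λ (measurable_one.indicator hs)),
    specIntegral_specIntegral hL h (measurable_one.indicator hs)]

/-- Such an event is a preimage under the restriction to `Δ`. -/
theorem mem_iff_of_measurableSet_cylinderEvents {ι : Type*} {X : ι → Type*}
    [∀ i, MeasurableSpace (X i)] {Δ : Set ι} {B : Set (∀ i, X i)}
    (hB : MeasurableSet[cylinderEvents Δ] B) {x y : ∀ i, X i} (hxy : ∀ i ∈ Δ, x i = y i) :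
    x ∈ B ↔ y ∈ B := by
  have h : cylinderEvents (X := X) Δ ≤ MeasurableSpace.comap Δ.domRestrict MeasurableSpace.pi := by
    refine iSup₂_le fun i hi => ?_
    rw [← measurable_iff_comap_le]
    exact (measurable_pi_apply (X := fun j : Δ => X j) ⟨i, hi⟩).comp (comap_measurable _)
  obtain ⟨B', -, rfl⟩ := h _ hB
  have : Δ.domRestrict x = Δ.domRestrict y := funext fun i => hxy i i.2
  simp [this]

/-- Gluing leaves the exterior untouched, so an exterior event is decided by `ξ` alone and factors
out. -/
theorem gibbsKernel_inter (Λ : Finset (Site d)) (ξ : Site d → Spin L)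
    {A : Set (Λ → Spin L)} (hA : MeasurableSet A) {B : Set (Site d → Spin L)}
    (hB : MeasurableSet[cylinderEvents ((Λ : Set (Site d))ᶜ)] B) :
    gibbsKernel ε Λ ξ ({x | Λ.restrict x ∈ A} ∩ B) =
      B.indicator (fun ξ => truncatedSpec ε L Λ ξ A) ξ := by
  have hres : ∀ x : Λ → Spin L, Λ.restrict (glue Λ x ξ) = x := fun x => by
    ext i; simp [glue]
  have hmem : ∀ x : Λ → Spin L, glue Λ x ξ ∈ B ↔ ξ ∈ B := fun x =>
    mem_iff_of_measurableSet_cylinderEvents hB fun i hi => by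
      have : i ∉ Λ := hi
      simp [glue, this]
  have hA' : MeasurableSet {x : Site d → Spin L | Λ.restrict x ∈ A} :=
    (Finset.measurable_restrict Λ) hA
  rw [gibbsKernel, Measure.map_apply (measurable_glue Λ ξ)
    (hA'.inter (cylinderEvents_le_pi _ hB))]
  by_cases h : ξ ∈ B
  · rw [Set.indicator_of_mem h]
    congr 1
    ext x
    simp [hres, hmem, h]
  · rw [Set.indicator_of_notMem h]
    convert measure_empty (μ := truncatedSpec ε L Λ ξ)
    ext x
    simp [hmem, h]

theorem measurable_truncatedSpec_apply (hL : 0 < L) (Λ : Finset (Site d))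
    {A : Set (Λ → Spin L)} (hA : MeasurableSet A) :
    Measurable[cylinderEvents ((Λ : Set (Site d))ᶜ)] fun ξ => truncatedSpec ε L Λ ξ A := by
  have hA' : MeasurableSet {x : Site d → Spin L | Λ.restrict x ∈ A} :=
    (Finset.measurable_restrict Λ) hA
  have key : ∀ ξ, truncatedSpec ε L Λ ξ A =
      specIntegral ε Λ ({x : Site d → Spin L | Λ.restrict x ∈ A}.indicator 1) ξ := fun ξ => by
    rw [← gibbsKernel_apply hL Λ ξ hA']
    simpa using (gibbsKernel_inter (ε := ε) Λ ξ hA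
      (B := Set.univ) MeasurableSet.univ).symm
  -- Overwriting the spins in `Λ` by `0` does not change the specification and makes its dependence
  -- on the exterior alone explicit.
  let φ : (Site d → Spin L) → (Site d → Spin L) := fun ξ =>
    glue Λ (fun _ => ⟨0, by constructor <;> linarith⟩) ξ
  have hφ : Measurable[cylinderEvents ((Λ : Set (Site d))ᶜ)] φ := by
    rw [@measurable_pi_iff]
    intro i
    by_cases hi : i ∈ Λ
    · simp only [φ, glue, hi, dite_true]
      exact @measurable_const _ _ _ (cylinderEvents _) _
    · simp only [φ, glue, hi, dite_false]
      exact measurable_cylinderEvent_apply (by simpa using hi)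
  have h2 : (fun ξ => truncatedSpec ε L Λ ξ A) =
      specIntegral ε Λ ({x : Site d → Spin L | Λ.restrict x ∈ A}.indicator 1) ∘ φ := by
    ext ξ
    rw [key, Function.comp]
    exact specIntegral_congr_ext Λ _ fun i hi => by simp [φ, glue, hi]
  rw [h2]
  exact (measurable_specIntegral Λ
    (measurable_one.indicator hA')).comp hφ

/-- On an event `{x_Λ ∈ A} ∩ B` with `B` exterior, invariance is the DLR equation integrated over
`B`. Every finite box splits into constraints inside and outside `Λ`, so these events determine the
measure. -/
theorem IsTruncatedGibbs.isSpecInvariant (hL : 0 < L) {μ : Measure (Site d → Spin L)}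
    (h : IsTruncatedGibbs ε L μ) (Λ : Finset (Site d)) : IsSpecInvariant ε Λ μ := by
  have := h.isProbabilityMeasure
  have hp := isProbabilityMeasure_truncatedSpec (d := d) (ε := ε) hL
  have hk := isProbabilityMeasure_gibbsKernel (d := d) (ε := ε) hL Λ
  have hmk := measurable_gibbsKernel (d := d) (ε := ε) hL Λ
  have key : ∀ {A : Set (Λ → Spin L)} (_ : MeasurableSet A) {B : Set (Site d → Spin L)}
      (_ : MeasurableSet[cylinderEvents ((Λ : Set (Site d))ᶜ)] B),
      μ.bind (gibbsKernel ε Λ) ({x | Λ.restrict x ∈ A} ∩ B) = μ ({x | Λ.restrict x ∈ A} ∩ B) := by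
    intro A hA B hB
    have hB' := cylinderEvents_le_pi _ hB
    have hA' : MeasurableSet {x : Site d → Spin L | Λ.restrict x ∈ A} :=
      (Finset.measurable_restrict Λ) hA
    rw [Measure.bind_apply (hA'.inter hB') hmk.aemeasurable]
    simp only [gibbsKernel_inter Λ _ hA hB]
    rw [lintegral_indicator hB']
    have h1 : ∫ ξ in B, (truncatedSpec ε L Λ ξ).real A ∂μ =
        μ.real ({x | Λ.restrict x ∈ A} ∩ B) := by
      rw [← setIntegral_congr_ae hB' ((h.dlr Λ A hA).mono fun _ h _ => h),
        setIntegral_condExp cylinderEvents_le_pi ((integrable_const 1).indicator hA') hB,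
        setIntegral_indicator hA', Set.inter_comm]
      simp
    have h2 : ∫⁻ ξ in B, truncatedSpec ε L Λ ξ A ∂μ =
        ENNReal.ofReal (∫ ξ in B, (truncatedSpec ε L Λ ξ).real A ∂μ) := by
      rw [ofReal_integral_eq_lintegral_ofReal]
      · simp
      · refine Integrable.of_bound (C := 1) ?_ (Filter.Eventually.of_forall fun ξ => ?_)
        · exact (((measurable_truncatedSpec_apply hL Λ hA).mono
            cylinderEvents_le_pi le_rfl).ennreal_toReal).aestronglyMeasurable
        · rw [Real.norm_eq_abs, abs_of_nonneg measureReal_nonneg]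
          exact measureReal_le_one
      · exact Filter.Eventually.of_forall fun ξ => measureReal_nonneg
    rw [h2, h1, ofReal_measureReal]
  refine (ext_of_generate_finite _ generateFrom_squareCylinders.symm
    (isPiSystem_squareCylinders (fun _ => MeasurableSpace.isPiSystem_measurableSet)
      (fun _ => MeasurableSet.univ)) ?_ ?_).symm
  · rintro _ ⟨s, t, ht, rfl⟩
    have ht' : ∀ i, MeasurableSet (t i) := fun i => ht i (Set.mem_univ i)
    have hA : MeasurableSet {x : Λ → Spin L | ∀ i : Λ, i.1 ∈ s → x i ∈ t i} := by
      simp only [Set.ofPred_forall]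
      exact MeasurableSet.iInter fun i => MeasurableSet.iInter fun _ =>
        (measurable_pi_apply i) (ht' i)
    have hB : MeasurableSet[cylinderEvents ((Λ : Set (Site d))ᶜ)]
        {x : Site d → Spin L | ∀ i ∈ s \ Λ, x i ∈ t i} := by
      simp only [Set.ofPred_forall]
      refine Finset.measurableSet_biInter _ fun i hi => ?_
      exact (measurable_cylinderEvent_apply (X := fun _ => Spin L)
        (by simpa using (Finset.mem_sdiff.1 hi).2)) (ht' i)
    have : (s : Set (Site d)).pi t = {x : Site d → Spin L |
        Λ.restrict x ∈ {x : Λ → Spin L | ∀ i : Λ, i.1 ∈ s → x i ∈ t i}} ∩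
        {x : Site d → Spin L | ∀ i ∈ s \ Λ, x i ∈ t i} := by
      ext x
      simp only [Set.mem_pi, Finset.mem_coe, Set.mem_inter_iff, Set.mem_ofPred_eq,
        Finset.restrict, Finset.mem_sdiff, Subtype.forall]
      refine ⟨fun h => ⟨fun i _ hi => h i hi, fun i hi => h i hi.1⟩, fun h i hi => ?_⟩
      by_cases hΛ : i ∈ Λ
      · exact h.1 i hΛ hi
      · exact h.2 i ⟨hi, hΛ⟩
    rw [this, key hA hB]
  · rw [Measure.bind_apply MeasurableSet.univ hmk.aemeasurable]
    simp

/-- Conversely, invariance tested on `{x_Λ ∈ A} ∩ B` gives the integrals over exterior events `B`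
that characterise the conditional expectation. -/
theorem isTruncatedGibbs_of_isSpecInvariant (hL : 0 < L) {μ : Measure (Site d → Spin L)}
    [IsProbabilityMeasure μ] (h : ∀ Λ, IsSpecInvariant ε Λ μ) : IsTruncatedGibbs ε L μ := by
  have hp := isProbabilityMeasure_truncatedSpec (d := d) (ε := ε) hL
  refine ⟨inferInstance, fun Λ A hA => Filter.EventuallyEq.symm ?_⟩
  have hA' : MeasurableSet {x : Site d → Spin L | Λ.restrict x ∈ A} :=
    (Finset.measurable_restrict Λ) hA
  have hm := measurable_truncatedSpec_apply (ε := ε) hL Λ hA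
  have hg_int : Integrable (fun ξ => (truncatedSpec ε L Λ ξ).real A) μ := by
    refine Integrable.of_bound (C := 1) ?_ (Filter.Eventually.of_forall fun ξ => ?_)
    · exact ((hm.mono cylinderEvents_le_pi le_rfl).ennreal_toReal).aestronglyMeasurable
    · rw [Real.norm_eq_abs, abs_of_nonneg measureReal_nonneg]
      exact measureReal_le_one
  refine ae_eq_condExp_of_forall_setIntegral_eq cylinderEvents_le_pi
    ((integrable_const 1).indicator hA') (fun B _ _ => hg_int.integrableOn) ?_
    (hm.ennreal_toReal).stronglyMeasurable.aestronglyMeasurable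
  intro B hB _
  have hB' := cylinderEvents_le_pi _ hB
  rw [setIntegral_indicator hA', Set.inter_comm]
  have h1 : μ ({x | Λ.restrict x ∈ A} ∩ B) = ∫⁻ ξ in B, truncatedSpec ε L Λ ξ A ∂μ := by
    conv_lhs => rw [← h Λ, Measure.bind_apply (hA'.inter hB')
      (measurable_gibbsKernel hL Λ).aemeasurable]
    simp only [gibbsKernel_inter Λ _ hA hB]
    rw [lintegral_indicator hB']
  have h2 : ∫ ξ in B, (truncatedSpec ε L Λ ξ).real A ∂μ =
      (∫⁻ ξ in B, truncatedSpec ε L Λ ξ A ∂μ).toReal :=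
    integral_toReal (hm.mono cylinderEvents_le_pi le_rfl).aemeasurable
      (Filter.Eventually.of_forall fun ξ => measure_lt_top _ _)
  rw [h2, ← h1]
  simp [Measure.real]

end

/-! ### Product measures -/

theorem infinitePi_prod_map_update {ι : Type*} [DecidableEq ι] {X : ι → Type*}
    [∀ i, MeasurableSpace (X i)] (μ : ∀ i, Measure (X i)) [∀ i, IsProbabilityMeasure (μ i)]
    (i : ι) :
    ((Measure.infinitePi μ).prod (μ i)).map (fun p => Function.update p.1 i p.2) =
      Measure.infinitePi μ := by
  refine Measure.eq_infinitePi _ fun s t ht => ?_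
  rw [Measure.map_apply measurable_update' (.pi s.countable_toSet fun _ _ => ht _)]
  have h : (fun p : (∀ j, X j) × X i => Function.update p.1 i p.2) ⁻¹' (s : Set ι).pi t =
      ((s.erase i : Finset ι) : Set ι).pi t ×ˢ (if i ∈ s then t i else Set.univ) := by
    ext ⟨x, z⟩
    simp only [Set.mem_preimage, Set.mem_pi, Finset.mem_coe, Set.mem_prod, Finset.mem_erase]
    constructor
    · intro h
      refine ⟨fun j hj => by simpa [hj.1] using h j hj.2, ?_⟩
      split_ifs with hi
      · simpa using h i hi
      · trivial
    · rintro ⟨h1, h2⟩ j hj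
      by_cases hji : j = i
      · subst hji
        simpa [hj] using h2
      · simpa [hji] using h1 j ⟨hji, hj⟩
  rw [h, Measure.prod_prod, Measure.infinitePi_pi _ fun i _ => ht i]
  split_ifs with hi
  · rw [mul_comm, Finset.mul_prod_erase s (fun i => μ i (t i)) hi]
  · simp [Finset.erase_eq_of_notMem hi]

theorem lintegral_infinitePi_eq_lintegral_update {ι : Type*} [DecidableEq ι] {X : ι → Type*}
    [∀ i, MeasurableSpace (X i)] (μ : ∀ i, Measure (X i)) [∀ i, IsProbabilityMeasure (μ i)]
    (i : ι) {f : (∀ i, X i) → ENNReal} (hf : Measurable f) :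
    ∫⁻ x, f x ∂Measure.infinitePi μ =
      ∫⁻ x, ∫⁻ z, f (Function.update x i z) ∂μ i ∂Measure.infinitePi μ := by
  conv_lhs => rw [← infinitePi_prod_map_update μ i, lintegral_map hf measurable_update']
  exact lintegral_prod _ (hf.comp measurable_update').aemeasurable

/-- The first time slice of a space-time configuration. -/
def headSlice {ι Y : Type*} (y : ι → ℕ → Y) : ι → Y := fun i => y i 0

/-- The space-time configuration without its first time slice. -/
def tailSlices {ι Y : Type*} (y : ι → ℕ → Y) : ι → ℕ → Y := fun i n => y i (n + 1)

/-- The space-time configuration with a given first time slice and given later slices. -/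
def consSlice {ι Y : Type*} (p : (ι → Y) × (ι → ℕ → Y)) : ι → ℕ → Y :=
  fun i n => Nat.casesOn n (p.1 i) fun n => p.2 i n

theorem measurable_headSlice {ι Y : Type*} [MeasurableSpace Y] :
    Measurable (headSlice : (ι → ℕ → Y) → _) := by
  unfold headSlice
  fun_prop

theorem measurable_tailSlices {ι Y : Type*} [MeasurableSpace Y] :
    Measurable (tailSlices : (ι → ℕ → Y) → _) := by
  unfold tailSlices
  fun_prop

theorem measurable_consSlice {ι Y : Type*} [MeasurableSpace Y] :
    Measurable (consSlice : (ι → Y) × (ι → ℕ → Y) → _) := by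
  refine measurable_pi_iff.2 fun i => measurable_pi_iff.2 fun n => ?_
  cases n
  · simp only [consSlice]
    fun_prop
  · simp only [consSlice]
    fun_prop

/-- The product measure on space-time configurations. -/
abbrev spaceTimeMeasure (ι : Type*) {Y : Type*} [MeasurableSpace Y] (ν : Measure Y)
    [IsProbabilityMeasure ν] : Measure (ι → ℕ → Y) :=
  Measure.infinitePi fun _ : ι => Measure.infinitePi fun _ : ℕ => ν

/-- The most recent slice is independent of the earlier ones, and the latter have the law of the
whole. After uncurrying, a box over `ι × ℕ` splits into its constraints at time `0` and at positive
times. -/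
theorem spaceTimeMeasure_map_consSlice (ι : Type*) {Y : Type*} [MeasurableSpace Y] (ν : Measure Y)
    [IsProbabilityMeasure ν] :
    ((Measure.infinitePi fun _ : ι => ν).prod (spaceTimeMeasure ι ν)).map consSlice =
      spaceTimeMeasure ι ν := by
  classical
  have hbox : ∀ (s : Finset (ι × ℕ)) (t : ι × ℕ → Set Y), (∀ p, MeasurableSet (t p)) →
      spaceTimeMeasure ι ν {y | ∀ p ∈ s, y p.1 p.2 ∈ t p} = ∏ p ∈ s, ν (t p) := by
    intro s t ht
    have h := Measure.infinitePi_map_curry_symm (fun (_ : ι) (_ : ℕ) => ν)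
    have h2 := congrArg (fun m => m ((s : Set (ι × ℕ)).pi t)) h
    rw [Measure.infinitePi_pi _ fun i _ => ht i, Measure.map_apply (by fun_prop)
      (.pi s.countable_toSet fun _ _ => ht _)] at h2
    exact h2
  refine (MeasurableEquiv.curry ι ℕ Y).symm.map_measurableEquiv_injective ?_
  rw [Measure.infinitePi_map_curry_symm (fun (_ : ι) (_ : ℕ) => ν)]
  refine Measure.eq_infinitePi _ fun s t ht => ?_
  rw [Measure.map_map (by fun_prop) measurable_consSlice,
    Measure.map_apply ((MeasurableEquiv.measurable _).comp measurable_consSlice)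
      (.pi s.countable_toSet fun _ _ => ht _)]
  have inj0 : Function.Injective fun i : ι => (i, 0) := fun i j h => (Prod.ext_iff.1 h).1
  have inj1 : Function.Injective fun p : ι × ℕ => (p.1, p.2 + 1) := fun p q h => by
    simp only [Prod.mk.injEq, add_left_inj] at h
    exact Prod.ext h.1 h.2
  have h : ((MeasurableEquiv.curry ι ℕ Y).symm ∘ consSlice) ⁻¹' (s : Set (ι × ℕ)).pi t =
      ((s.preimage (fun i => (i, 0)) inj0.injOn : Finset ι) : Set ι).pi (fun i => t (i, 0)) ×ˢ
      {y | ∀ p ∈ s.preimage (fun p : ι × ℕ => (p.1, p.2 + 1)) inj1.injOn,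
        y p.1 p.2 ∈ t (p.1, p.2 + 1)} := by
    ext ⟨a, y⟩
    simp only [Set.mem_preimage, Set.mem_pi, Finset.mem_coe, Set.mem_prod, Finset.mem_preimage,
      Set.mem_ofPred_eq, Prod.forall]
    constructor
    · intro h
      exact ⟨fun i hi => h i 0 hi, fun i n hi => h i (n + 1) hi⟩
    · rintro ⟨h1, h2⟩ i n hi
      cases n with
      | zero => exact h1 i hi
      | succ n => exact h2 i n hi
  rw [h, Measure.prod_prod, Measure.infinitePi_pi _ fun i _ => ht _,
    hbox _ (fun p => t (p.1, p.2 + 1)) fun p => ht _,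
    Finset.prod_preimage' (fun i : ι => (i, 0)) s inj0.injOn (fun p => ν (t p)),
    Finset.prod_preimage' (fun p : ι × ℕ => (p.1, p.2 + 1)) s inj1.injOn (fun p => ν (t p)),
    ← Finset.prod_filter_mul_prod_filter_not s (fun p => p.2 = 0) (fun p => ν (t p))]
  congr 2
  · ext ⟨i, n⟩
    simp [eq_comm]
  · ext ⟨i, n⟩
    cases n <;> simp

theorem measurePreserving_headSlice_tailSlices (ι : Type*) {Y : Type*} [MeasurableSpace Y]
    (ν : Measure Y) [IsProbabilityMeasure ν] :
    MeasurePreserving (fun y : ι → ℕ → Y => (headSlice y, tailSlices y)) (spaceTimeMeasure ι ν)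
      ((Measure.infinitePi fun _ : ι => ν).prod (spaceTimeMeasure ι ν)) := by
  have hm : Measurable fun y : ι → ℕ → Y => (headSlice y, tailSlices y) :=
    measurable_headSlice.prodMk measurable_tailSlices
  refine ⟨hm, ?_⟩
  conv_lhs => rw [← spaceTimeMeasure_map_consSlice ι ν]
  rw [Measure.map_map hm measurable_consSlice]
  exact Measure.map_id

/-! ### The local dynamics -/

/-- The law of a fair coin. -/
def coinMeasure : Measure Bool := (PMF.uniformOfFintype Bool).toMeasure

instance : IsProbabilityMeasure coinMeasure := by
  unfold coinMeasure
  infer_instance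

theorem coinMeasure_singleton (b : Bool) : coinMeasure {b} = 2⁻¹ := by
  rw [coinMeasure, PMF.toMeasure_uniformOfFintype_apply _ (measurableSet_singleton b)]
  simp

/-- The law of a free spin: the Gaussian law conditioned to `[-L, L]`. -/
def freeSpin (L : ℝ) : Measure (Spin L) := (spinVolume L).tilted fun z => -(z.1 ^ 2 / 2)

theorem integrable_exp_neg_sq (L : ℝ) :
    Integrable (fun z : Spin L => Real.exp (-(z.1 ^ 2 / 2))) (spinVolume L) := by
  refine Integrable.of_bound (C := 1) (by fun_prop) (Filter.Eventually.of_forall fun z => ?_)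
  rw [Real.norm_eq_abs, Real.abs_exp, Real.exp_le_one_iff]
  have := sq_nonneg z.1
  linarith

instance (L : ℝ) [hL : Fact (0 < L)] : IsProbabilityMeasure (freeSpin L) := by
  have := spinVolume_ne_zero hL.out
  exact isProbabilityMeasure_tilted (integrable_exp_neg_sq L)

/-- A proposed spin and a uniform variable that decides about its acceptance. -/
abbrev Proposal (L : ℝ) : Type := Spin L × unitInterval

/-- The law of a proposal. -/
def proposalMeasure (L : ℝ) : Measure (Proposal L) := (freeSpin L).prod volume

instance (L : ℝ) [Fact (0 < L)] : IsProbabilityMeasure (proposalMeasure L) := by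
  unfold proposalMeasure
  infer_instance

/-- The randomness used at one site and one time. -/
abbrev Seed (L : ℝ) : Type := Bool × Proposal L

/-- The law of a seed. -/
def seedMeasure (L : ℝ) : Measure (Seed L) := coinMeasure.prod (proposalMeasure L)

instance (L : ℝ) [Fact (0 < L)] : IsProbabilityMeasure (seedMeasure L) := by
  unfold seedMeasure
  infer_instance

/-- The nearest neighbours of a site. -/
def neighbours {d : ℕ} (i : Site d) : Finset (Site d) :=
  Finset.univ.image (fun k => i + Pi.single k 1) ∪ Finset.univ.image (fun k => i - Pi.single k 1)

/-- The coins of a family of seeds. -/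
def coins {d : ℕ} {L : ℝ} (ω : Site d → Seed L) : Site d → Bool := fun i => (ω i).1

/-- A site is active if its coin shows `true` and those of its neighbours show `false`. -/
def IsActive {d : ℕ} (c : Site d → Bool) (i : Site d) : Prop :=
  c i = true ∧ ∀ j ∈ neighbours i, c j = false

/-- The probability to accept the proposed spin `z` at the site `i`. -/
def acceptance {d : ℕ} {L : ℝ} (ε : ℝ) (i : Site d) (x : Site d → Spin L) (z : Spin L) : ℝ :=
  Real.exp (localField ε i x * z.1 - |ε| * L ^ 2)

open Classical in
/-- The update of the spin at `i` by rejection sampling from its conditional law. -/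
def siteUpdate {d : ℕ} {L : ℝ} (ε : ℝ) (i : Site d) (v : Proposal L) (x : Site d → Spin L) :
    Site d → Spin L :=
  if v.2.1 ≤ acceptance ε i x v.1 then Function.update x i v.1 else x

open Classical in
/-- The simultaneous update of the spins at all active sites of `V`. -/
def sweep {d : ℕ} {L : ℝ} (ε : ℝ) (V : Set (Site d)) (ω : Site d → Seed L)
    (x : Site d → Spin L) : Site d → Spin L := fun i =>
  if i ∈ V ∧ IsActive (coins ω) i ∧ (ω i).2.2.1 ≤ acceptance ε i x (ω i).2.1
  then (ω i).2.1 else x i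

section
variable {d : ℕ} {L : ℝ} {ε : ℝ}

/-! ### Neighbourhoods, acceptance bounds and measurability -/

theorem mem_neighbours {i j : Site d} :
    j ∈ neighbours i ↔ ∃ k, j = i + Pi.single k 1 ∨ j = i - Pi.single k 1 := by
  simp only [neighbours, Finset.mem_union, Finset.mem_image, Finset.mem_univ, true_and,
    exists_or, eq_comm]

theorem self_notMem_neighbours (i : Site d) : i ∉ neighbours i := by
  rw [mem_neighbours]
  rintro ⟨k, h | h⟩
  · have := congrFun h k
    simp at this
  · have := congrFun h k
    simp only [Pi.sub_apply, Pi.single_eq_same] at this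
    omega

theorem card_neighbours_le (i : Site d) : (neighbours i).card ≤ 2 * d := by
  refine (Finset.card_union_le _ _).trans ?_
  have h1 := Finset.card_image_le (s := Finset.univ) (f := fun k : Fin d => i + Pi.single k (1 : ℤ))
  have h2 := Finset.card_image_le (s := Finset.univ) (f := fun k : Fin d => i - Pi.single k (1 : ℤ))
  simp only [Finset.card_univ, Fintype.card_fin] at h1 h2
  omega

theorem localField_congr {i : Site d} {x y : Site d → Spin L}
    (h : ∀ j ∈ neighbours i, x j = y j) : localField ε i x = localField ε i y := by
  unfold localField
  congr 1
  refine Finset.sum_congr rfl fun k _ => ?_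
  rw [h _ (mem_neighbours.2 ⟨k, Or.inl rfl⟩), h _ (mem_neighbours.2 ⟨k, Or.inr rfl⟩)]

theorem acceptance_congr {i : Site d} {x y : Site d → Spin L} (z : Spin L)
    (h : ∀ j ∈ neighbours i, x j = y j) : acceptance ε i x z = acceptance ε i y z := by
  rw [acceptance, localField_congr h, acceptance]

theorem acceptance_le_one (i : Site d) (x : Site d → Spin L) (z : Spin L) :
    acceptance ε i x z ≤ 1 := by
  rw [acceptance, Real.exp_le_one_iff]
  linarith [le_abs_self (localField ε i x * z.1), abs_localField_mul_le (ε := ε) i x z]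

theorem exp_le_acceptance (i : Site d) (x : Site d → Spin L) (z : Spin L) :
    Real.exp (-(2 * (|ε| * L ^ 2))) ≤ acceptance ε i x z := by
  rw [acceptance, Real.exp_le_exp]
  linarith [neg_abs_le (localField ε i x * z.1), abs_localField_mul_le (ε := ε) i x z]

theorem measurable_localField (i : Site d) : Measurable (localField (L := L) ε i) := by
  unfold localField
  fun_prop

theorem Measurable.acceptance {α : Type*} [MeasurableSpace α] {x : α → Site d → Spin L}
    {z : α → Spin L} (hx : Measurable x) (hz : Measurable z) (i : Site d) :
    Measurable fun a => acceptance ε i (x a) (z a) := by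
  unfold _root_.acceptance
  have := (measurable_localField (L := L) (ε := ε) i).comp hx
  fun_prop

theorem measurable_siteUpdate (i : Site d) :
    Measurable fun p : Proposal L × (Site d → Spin L) => siteUpdate ε i p.1 p.2 := by
  unfold siteUpdate
  have hp : Measurable fun p : Proposal L × (Site d → Spin L) => (p.2, p.1.1) := by fun_prop
  have hu : Measurable fun p : Proposal L × (Site d → Spin L) => Function.update p.2 i p.1.1 :=
    measurable_update'.comp hp
  have ha : Measurable fun p : Proposal L × (Site d → Spin L) => acceptance ε i p.2 p.1.1 :=
    measurable_snd.acceptance (by fun_prop) i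
  exact Measurable.ite (measurableSet_le (by fun_prop) ha) hu measurable_snd

theorem measurable_coins : Measurable (coins : (Site d → Seed L) → _) := by
  unfold coins
  fun_prop

theorem measurableSet_isActive (i : Site d) : MeasurableSet {c : Site d → Bool | IsActive c i} := by
  have h : ∀ (j : Site d) (b : Bool), MeasurableSet {c : Site d → Bool | c j = b} := fun j b =>
    (measurable_pi_apply j : Measurable fun c : Site d → Bool => c j) (measurableSet_singleton b)
  have h2 : {c : Site d → Bool | IsActive c i} =
      {c | c i = true} ∩ ⋂ j ∈ neighbours i, {c | c j = false} := by
    ext c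
    simp [IsActive]
  rw [h2]
  exact (h i true).inter (Finset.measurableSet_biInter _ fun j _ => h j false)

theorem measurable_sweep (V : Set (Site d)) :
    Measurable fun p : (Site d → Seed L) × (Site d → Spin L) => sweep ε V p.1 p.2 := by
  refine measurable_pi_iff.2 fun i => ?_
  unfold sweep
  have ha : Measurable fun p : (Site d → Seed L) × (Site d → Spin L) =>
      acceptance ε i p.2 (p.1 i).2.1 := measurable_snd.acceptance (by fun_prop) i
  have hc : MeasurableSet {p : (Site d → Seed L) × (Site d → Spin L) | IsActive (coins p.1) i} :=
    (measurable_coins.comp measurable_fst) (measurableSet_isActive i)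
  refine Measurable.ite ?_ (by fun_prop) (by fun_prop)
  exact (MeasurableSet.const _).inter (hc.inter (measurableSet_le (by fun_prop) ha))

/-! ### Stationarity of the local dynamics -/

theorem lintegral_unitInterval_ite {a : ℝ} (h0 : 0 ≤ a) (h1 : a ≤ 1) (A B : ENNReal) :
    (∫⁻ u : unitInterval, if u.1 ≤ a then A else B) =
      A * ENNReal.ofReal a + B * (1 - ENNReal.ofReal a) := by
  classical
  have hs : MeasurableSet (Set.Iic (⟨a, h0, h1⟩ : unitInterval)) := measurableSet_Iic
  have : (fun u : unitInterval => if u.1 ≤ a then A else B) =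
      fun u => (Set.Iic (⟨a, h0, h1⟩ : unitInterval)).indicator (fun _ => A) u +
        (Set.Iic (⟨a, h0, h1⟩ : unitInterval))ᶜ.indicator (fun _ => B) u := by
    ext u
    by_cases hu : u.1 ≤ a
    · have h2 : u ∈ Set.Iic (⟨a, h0, h1⟩ : unitInterval) := hu
      rw [if_pos hu, Set.indicator_of_mem h2, Set.indicator_of_notMem (by simpa using h2), add_zero]
    · have h2 : u ∉ Set.Iic (⟨a, h0, h1⟩ : unitInterval) := hu
      rw [if_neg hu, Set.indicator_of_notMem h2, Set.indicator_of_mem (by exact h2), zero_add]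
  rw [this, lintegral_add_left (measurable_const.indicator hs), lintegral_indicator hs,
    lintegral_indicator hs.compl, setLIntegral_const, setLIntegral_const, prob_compl_eq_one_sub hs,
    unitInterval.volume_Iic]

theorem weightedIntegral_singleton (i : Site d) (f : (Site d → Spin L) → ENNReal)
    (x : Site d → Spin L) :
    weightedIntegral ε {i} f x = ∫⁻ z, ENNReal.ofReal
      (Real.exp (localField ε i x * z.1 - z.1 ^ 2 / 2)) * f (Function.update x i z)
        ∂spinVolume L := by
  rw [weightedIntegral, lmarginal_singleton]
  refine lintegral_congr fun z => ?_
  simp only [boltzmann]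
  rw [hamiltonian_singleton_update, neg_sub]

/-- The free density times the acceptance probability is the single-site Boltzmann weight up to the
factor `exp (-|ε| L²) / ∫ exp (-z² / 2)`. That this factor does not depend on `x` is what makes
rejection sampling work. -/
theorem lintegral_acceptance_mul (hL : 0 < L) (i : Site d) :
    ∃ c : ENNReal, ∀ (x : Site d → Spin L) (f : (Site d → Spin L) → ENNReal), Measurable f →
      ∫⁻ z, f (Function.update x i z) * ENNReal.ofReal (acceptance ε i x z) ∂freeSpin L =
        c * weightedIntegral ε {i} f x := by
  have := spinVolume_ne_zero hL
  have hZ := integral_exp_pos (integrable_exp_neg_sq L)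
  refine ⟨ENNReal.ofReal (Real.exp (-(|ε| * L ^ 2)) /
    ∫ z : Spin L, Real.exp (-(z.1 ^ 2 / 2)) ∂spinVolume L), fun x f hf => ?_⟩
  have hm : Measurable fun z => f (Function.update x i z) := hf.comp (measurable_update x)
  rw [freeSpin, lintegral_tilted, weightedIntegral_singleton, ← lintegral_const_mul _ (by fun_prop)]
  refine lintegral_congr fun z => ?_
  rw [mul_left_comm, mul_comm, ← ENNReal.ofReal_mul (by positivity), ← mul_assoc,
    ← ENNReal.ofReal_mul (by positivity), div_mul_eq_mul_div, div_mul_eq_mul_div, acceptance,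
    ← Real.exp_add, ← Real.exp_add]
  congr 4
  ring_nf

/-- The update mixes, with weights `a(x)` and `1 - a(x)`, exact resampling at `i` and the identity.
The total acceptance probability `a` does not depend on the spin at `i`, so invariance under
resampling can be applied to `a f`. -/
theorem IsSpecInvariant.lintegral_siteUpdate [hL : Fact (0 < L)] {i : Site d}
    {μ : Measure (Site d → Spin L)} (h : IsSpecInvariant ε {i} μ)
    {f : (Site d → Spin L) → ENNReal} (hf : Measurable f) :
    ∫⁻ x, ∫⁻ v, f (siteUpdate ε i v x) ∂proposalMeasure L ∂μ = ∫⁻ x, f x ∂μ := by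
  obtain ⟨c, hc⟩ := lintegral_acceptance_mul (ε := ε) hL.out i
  have hma : ∀ x : Site d → Spin L, Measurable fun z => ENNReal.ofReal (acceptance ε i x z) :=
    fun x => (measurable_const.acceptance measurable_id i).ennreal_ofReal
  have hle : ∀ x : Site d → Spin L, c * weightedIntegral ε {i} 1 x ≤ 1 := fun x => by
    rw [← hc x 1 measurable_one]
    calc _ ≤ ∫⁻ z, 1 ∂freeSpin L := by
          refine lintegral_mono fun z => ?_
          simpa using acceptance_le_one i x z
      _ = 1 := by simp
  -- Here `c * weightedIntegral ε {i} 1 x` is the total acceptance probability `a(x)`; it is moved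
  -- inside `specIntegral`.
  have hin : ∀ x : Site d → Spin L, ∫⁻ v, f (siteUpdate ε i v x) ∂proposalMeasure L =
      specIntegral ε {i} (fun x => c * weightedIntegral ε {i} 1 x * f x) x +
        (1 - c * weightedIntegral ε {i} 1 x) * f x := by
    intro x
    have hmz : Measurable fun z => f (Function.update x i z) := hf.comp (measurable_update x)
    have hmza : Measurable fun z =>
        f (Function.update x i z) * ENNReal.ofReal (acceptance ε i x z) := hmz.mul (hma x)
    have hmv : Measurable fun v : Proposal L => f (siteUpdate ε i v x) :=
      hf.comp ((measurable_siteUpdate (L := L) (ε := ε) i).comp measurable_prodMk_right)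
    rw [proposalMeasure, lintegral_prod _ hmv.aemeasurable]
    have h1 : ∀ z : Spin L, ∫⁻ u : unitInterval, f (siteUpdate ε i (z, u) x) =
        f (Function.update x i z) * ENNReal.ofReal (acceptance ε i x z) +
          f x * (1 - ENNReal.ofReal (acceptance ε i x z)) := by
      intro z
      rw [← lintegral_unitInterval_ite (a := acceptance ε i x z) (Real.exp_pos _).le
        (acceptance_le_one i x z)]
      refine lintegral_congr fun u => ?_
      simp only [siteUpdate, apply_ite f]
    simp only [h1]
    rw [lintegral_add_left hmza, lintegral_const_mul _ ((hma x).const_sub 1),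
      lintegral_sub (hma x) (ne_top_of_le_ne_top ENNReal.one_ne_top ?_)
        (Filter.Eventually.of_forall fun z => ?_), hc x f hf,
      specIntegral_mul_left _ hf fun ξ η hξ => by
        rw [weightedIntegral_congr_ext _ _ hξ], mul_assoc, specIntegral,
      ENNReal.mul_div_cancel (weightedIntegral_one_ne_zero hL.out _ x)
        (weightedIntegral_one_ne_top _ x), mul_comm (f x)]
    · have := hc x 1 measurable_one
      simp only [Pi.one_apply, one_mul] at this
      rw [this]
      simp
    · have := hc x 1 measurable_one
      simp only [Pi.one_apply, one_mul] at this
      rw [this]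
      exact hle x
    · simpa using acceptance_le_one i x z
  have hmc : Measurable fun x : Site d → Spin L => c * weightedIntegral ε {i} 1 x :=
    (measurable_weightedIntegral _ measurable_one).const_mul c
  have hmf : Measurable fun x : Site d → Spin L => c * weightedIntegral ε {i} 1 x * f x :=
    hmc.mul hf
  simp only [hin]
  rw [lintegral_add_left (measurable_specIntegral _ hmf),
    h.lintegral_specIntegral hL.out hmf, ← lintegral_add_left hmf]
  refine lintegral_congr fun x => ?_
  rw [← add_mul, add_tsub_cancel_of_le (hle x), one_mul]

-- If `i` is active, its neighbours are not, so the sweep of `V` has left them unchanged and the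
-- acceptance test at `i` gives the same answer after it as before. Simultaneous updates can thus be
-- performed one after the other. As `i ∉ V`, the sweep of `V` uses only the coin at `i`, which
-- leaves the proposal `v` free.
open Classical in
theorem sweep_insert {V : Set (Site d)} {i : Site d} (hi : i ∉ V) (ω : Site d → Seed L)
    (v : Proposal L) (x : Site d → Spin L) :
    sweep ε (insert i V) (Function.update ω i ((ω i).1, v)) x =
      if IsActive (coins ω) i then siteUpdate ε i v (sweep ε V ω x) else sweep ε V ω x := by
  have hc : coins (Function.update ω i ((ω i).1, v)) = coins ω := by
    ext j
    by_cases hj : j = i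
    · subst hj; simp [coins]
    · simp [coins, hj]
  have hoff : ∀ j, j ≠ i →
      sweep ε (insert i V) (Function.update ω i ((ω i).1, v)) x j = sweep ε V ω x j := by
    intro j hj
    simp only [sweep, hc, Set.mem_insert_iff, hj, false_or, Function.update_of_ne hj]
  have hself : sweep ε V ω x i = x i := by simp [sweep, hi]
  by_cases ha : IsActive (coins ω) i
  · have hacc : acceptance ε i (sweep ε V ω x) v.1 = acceptance ε i x v.1 := by
      refine acceptance_congr _ fun j hj => ?_
      have : ¬ IsActive (coins ω) j := fun h => by
        have := ha.2 j hj
        rw [h.1] at this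
        cases this
      simp [sweep, this]
    rw [if_pos ha]
    ext1 j
    by_cases hj : j = i
    · subst hj
      rw [siteUpdate, hacc, sweep, hc]
      simp only [Set.mem_insert_iff, true_or, ha, true_and, Function.update_self]
      split_ifs
      · simp
      · exact hself.symm
    · rw [hoff j hj, siteUpdate]
      split_ifs
      · simp [hj]
      · rfl
  · rw [if_neg ha]
    ext1 j
    by_cases hj : j = i
    · subst hj
      rw [hself, sweep, hc, if_neg (fun h => ha h.2.1)]
    · exact hoff j hj

/-- Refreshes the proposal at one site while keeping all coins, hence the set of active sites. -/
theorem lintegral_resample_proposal [Fact (0 < L)] (i : Site d)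
    {f : (Site d → Seed L) → ENNReal} (hf : Measurable f) :
    ∫⁻ ω, f ω ∂Measure.infinitePi (fun _ : Site d => seedMeasure L) =
      ∫⁻ ω, ∫⁻ v, f (Function.update ω i ((ω i).1, v)) ∂proposalMeasure L
        ∂Measure.infinitePi (fun _ : Site d => seedMeasure L) := by
  have hm : Measurable fun p : (Site d → Seed L) × Proposal L =>
      f (Function.update p.1 i ((p.1 i).1, p.2)) :=
    hf.comp (measurable_update'.comp (by fun_prop : Measurable
      fun p : (Site d → Seed L) × Proposal L => (p.1, ((p.1 i).1, p.2))))
  rw [lintegral_infinitePi_eq_lintegral_update _ i hf,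
    lintegral_infinitePi_eq_lintegral_update _ i hm.lintegral_prod_right']
  refine lintegral_congr fun ω => ?_
  have hmω : Measurable fun w : Seed L => f (Function.update ω i w) :=
    hf.comp (measurable_update ω)
  simp only [Function.update_self, Function.update_idem]
  rw [seedMeasure, lintegral_prod _ hmω.aemeasurable, lintegral_prod]
  · simp
  · exact (Measurable.lintegral_prod_right' (f := fun p : Seed L × Proposal L =>
      f (Function.update ω i (p.1.1, p.2))) (hmω.comp (by fun_prop))).aemeasurable

/-- Sites are added one at a time: given the coins, a fresh proposal at the new site acts by
`siteUpdate`, which preserves `μ`. The test function must see the coins for the induction, because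
whether the new site moves depends on them. -/
theorem lintegral_sweep [Fact (0 < L)] {μ : Measure (Site d → Spin L)} [SFinite μ]
    (V : Finset (Site d)) (h : ∀ i ∈ V, IsSpecInvariant ε {i} μ)
    {f : (Site d → Bool) × (Site d → Spin L) → ENNReal} (hf : Measurable f) :
    ∫⁻ ω, ∫⁻ x, f (coins ω, sweep ε V ω x) ∂μ
        ∂Measure.infinitePi (fun _ : Site d => seedMeasure L) =
      ∫⁻ ω, ∫⁻ x, f (coins ω, x) ∂μ ∂Measure.infinitePi (fun _ : Site d => seedMeasure L) := by
  classical
  induction V using Finset.induction_on generalizing f with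
  | empty =>
    have : ∀ (ω : Site d → Seed L) (x : Site d → Spin L), sweep ε ∅ ω x = x := fun ω x => by
      ext1 i
      simp [sweep]
    simp [this]
  | insert i V hi ih =>
    have hcoins : ∀ (ω : Site d → Seed L) v,
        coins (Function.update ω i ((ω i).1, v)) = coins ω := by
      intro ω v
      ext j
      by_cases hj : j = i
      · subst hj; simp [coins]
      · simp [coins, hj]
    have hm1 : Measurable fun p : (Site d → Seed L) × (Site d → Spin L) =>
        f (coins p.1, sweep ε (insert i V : Finset (Site d)) p.1 p.2) :=
      hf.comp ((measurable_coins.comp measurable_fst).prodMk (measurable_sweep _))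
    have hm2 : Measurable fun q : ((Site d → Bool) × (Site d → Spin L)) × Proposal L =>
        f (q.1.1, if IsActive q.1.1 i then siteUpdate ε i q.2 q.1.2 else q.1.2) := by
      have h1 : Measurable fun q : ((Site d → Bool) × (Site d → Spin L)) × Proposal L => q.1.1 := by
        fun_prop
      have h2 : Measurable fun q : ((Site d → Bool) × (Site d → Spin L)) × Proposal L =>
          (q.2, q.1.2) := by
        fun_prop
      have h3 : Measurable fun q : ((Site d → Bool) × (Site d → Spin L)) × Proposal L =>
          siteUpdate ε i q.2 q.1.2 := (measurable_siteUpdate (L := L) (ε := ε) i).comp h2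
      exact hf.comp (h1.prodMk (Measurable.ite (h1 (measurableSet_isActive i)) h3 (by fun_prop)))
    rw [lintegral_resample_proposal i hm1.lintegral_prod_right']
    simp only [hcoins, Finset.coe_insert, sweep_insert (by simpa using hi : i ∉ (V : Set (Site d)))]
    have hswap : ∀ ω : Site d → Seed L, ∫⁻ v, ∫⁻ x, f (coins ω, if IsActive (coins ω) i then
          siteUpdate ε i v (sweep ε V ω x) else sweep ε V ω x) ∂μ ∂proposalMeasure L =
        ∫⁻ x, ∫⁻ v, f (coins ω, if IsActive (coins ω) i then
          siteUpdate ε i v (sweep ε V ω x) else sweep ε V ω x) ∂proposalMeasure L ∂μ := by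
      intro ω
      refine lintegral_lintegral_swap (Measurable.aemeasurable ?_)
      have h1 : Measurable fun p : Proposal L × (Site d → Spin L) => sweep ε V ω p.2 :=
        (measurable_sweep (L := L) (ε := ε) (V : Set (Site d))).comp
          ((measurable_const (a := ω)).prodMk measurable_snd)
      have h2 : Measurable fun p : Proposal L × (Site d → Spin L) =>
          ((coins ω, sweep ε V ω p.2), p.1) :=
        (measurable_const.prodMk h1).prodMk measurable_fst
      exact hm2.comp h2
    simp only [hswap]
    rw [ih (fun j hj => h j (Finset.mem_insert_of_mem hj)) (f := fun q => ∫⁻ v, f (q.1,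
      if IsActive q.1 i then siteUpdate ε i v q.2 else q.2) ∂proposalMeasure L)
      hm2.lintegral_prod_right']
    refine lintegral_congr fun ω => ?_
    by_cases ha : IsActive (coins ω) i
    · simp only [ha, if_true]
      exact (h i (Finset.mem_insert_self _ _)).lintegral_siteUpdate
        (hf.comp measurable_prodMk_left)
    · simp [ha]

end

/-! ### Coupling from the past -/

/-- The configuration at time `0` of the dynamics in `V` started at time `-n` from `x`; the slice
`n` of `y` is used at time `-n`. -/
def run {d : ℕ} {L : ℝ} (ε : ℝ) (V : Set (Site d)) :
    ℕ → (Site d → ℕ → Seed L) → (Site d → Spin L) → (Site d → Spin L)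
  | 0, _, x => x
  | n + 1, y, x => sweep ε V (headSlice y) (run ε V n (tailSlices y) x)

/-- A proposal is accepted whatever the neighbouring spins if its uniform variable is at most
this threshold. -/
def sureAcceptance (ε L : ℝ) : ℝ := Real.exp (-(2 * (|ε| * L ^ 2)))

/-- The spin at `i` and time `0` may depend on the configuration at time `-n`. -/
def Alive {d : ℕ} {L : ℝ} (ε : ℝ) : ℕ → (Site d → ℕ → Seed L) → Site d → Prop
  | 0, _, _ => True
  | n + 1, y, i => (¬ IsActive (coins (headSlice y)) i ∧ Alive ε n (tailSlices y) i) ∨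
      (sureAcceptance ε L < (headSlice y i).2.2.1 ∧
        ∃ j ∈ insert i (neighbours i), Alive ε n (tailSlices y) j)

section
variable {d : ℕ} {L : ℝ} {ε : ℝ}

/-! ### Geometry of the lattice -/

theorem latticeDist_self (i : Site d) : latticeDist i i = 0 := by simp [latticeDist]

theorem latticeDist_comm (i j : Site d) : latticeDist i j = latticeDist j i := by
  unfold latticeDist
  exact Finset.sum_congr rfl fun k _ => by omega

theorem latticeDist_triangle (i j k : Site d) :
    latticeDist i k ≤ latticeDist i j + latticeDist j k := by
  unfold latticeDist
  rw [← Finset.sum_add_distrib]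
  exact Finset.sum_le_sum fun k _ => by omega

theorem latticeDist_add_left (k i j : Site d) :
    latticeDist (k + i) (k + j) = latticeDist i j := by
  simp [latticeDist]

theorem latticeDist_le_one_of_mem_neighbours {i j : Site d} (h : j ∈ neighbours i) :
    latticeDist j i ≤ 1 := by
  have h1 : ∀ k : Fin d, ∑ l, ((Pi.single k 1 : Site d) l).natAbs = 1 := by
    intro k
    rw [Finset.sum_eq_single k]
    · simp
    · intro l _ hl
      simp [hl]
    · simp
  obtain ⟨k, rfl | rfl⟩ := mem_neighbours.1 h
  · simp [latticeDist, h1]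
  · simp [latticeDist, h1]

theorem latticeDist_le_succ_of_mem {i j l : Site d} {n : ℕ} (hj : j ∈ insert i (neighbours i))
    (h : latticeDist l j ≤ n) : latticeDist l i ≤ n + 1 := by
  rcases Finset.mem_insert.1 hj with rfl | hj
  · omega
  · have := latticeDist_triangle l j i
    have := latticeDist_le_one_of_mem_neighbours hj
    omega

theorem finite_setOf_latticeDist_le (i : Site d) (n : ℕ) : {j | latticeDist j i ≤ n}.Finite := by
  refine (Set.finite_Icc (i - fun _ => (n : ℤ)) (i + fun _ => (n : ℤ))).subset fun j hj => ?_
  have hj' : ∀ k, (j k - i k).natAbs ≤ n := fun k =>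
    (Finset.single_le_sum (f := fun k => (j k - i k).natAbs) (fun _ _ => Nat.zero_le _)
      (Finset.mem_univ k)).trans hj
  constructor <;> intro k <;> have := hj' k <;> simp only [Pi.sub_apply, Pi.add_apply] <;> omega

theorem exists_finset_latticeDist_le (Δ : Finset (Site d)) (n : ℕ) :
    ∃ V : Finset (Site d), ∀ i ∈ Δ, ∀ j, latticeDist j i ≤ n → j ∈ V := by
  classical
  refine ⟨Δ.biUnion fun i => (finite_setOf_latticeDist_le i n).toFinset, fun i hi j hj => ?_⟩
  simp only [Finset.mem_biUnion, Set.Finite.mem_toFinset]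
  exact ⟨i, hi, hj⟩

theorem neighbours_add (k i : Site d) : neighbours (k + i) = (neighbours i).image (k + ·) := by
  ext j
  simp only [mem_neighbours, Finset.mem_image]
  constructor
  · rintro ⟨l, rfl | rfl⟩
    · exact ⟨i + Pi.single l 1, ⟨l, Or.inl rfl⟩, by abel⟩
    · exact ⟨i - Pi.single l 1, ⟨l, Or.inr rfl⟩, by abel⟩
  · rintro ⟨_, ⟨l, rfl | rfl⟩, rfl⟩
    · exact ⟨l, Or.inl (by abel)⟩
    · exact ⟨l, Or.inr (by abel)⟩

/-! #### Dependence on the past -/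

theorem sweep_congr {V V' : Set (Site d)} {ω ω' : Site d → Seed L} {x x' : Site d → Spin L}
    {i i' : Site d}
    (h : (i ∈ V ∧ IsActive (coins ω) i ∧ (ω i).2.2.1 ≤ acceptance ε i x (ω i).2.1) ↔
      (i' ∈ V' ∧ IsActive (coins ω') i' ∧ (ω' i').2.2.1 ≤ acceptance ε i' x' (ω' i').2.1))
    (hω : (ω i).2.1 = (ω' i').2.1) (hx : x i = x' i') :
    sweep ε V ω x i = sweep ε V' ω' x' i' := by
  unfold sweep
  by_cases h' : i ∈ V ∧ IsActive (coins ω) i ∧ (ω i).2.2.1 ≤ acceptance ε i x (ω i).2.1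
  · rw [if_pos h', if_pos (h.1 h'), hω]
  · rw [if_neg h', if_neg (mt h.2 h'), hx]

theorem isActive_congr {c c' : Site d → Bool} {i : Site d}
    (h : ∀ j ∈ insert i (neighbours i), c j = c' j) : IsActive c i ↔ IsActive c' i := by
  unfold IsActive
  rw [h i (Finset.mem_insert_self _ _)]
  refine and_congr_right fun _ => forall₂_congr fun j hj => ?_
  rw [h j (Finset.mem_insert_of_mem hj)]

/-- When `Alive` fails, the backward exploration ends before time `-n`, so the starting
configuration is never consulted. The exploration stays within distance `n`, where updates
restricted to `V` and unrestricted ones coincide. -/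
theorem run_eq_of_not_alive {V : Set (Site d)} {n : ℕ} {y : Site d → ℕ → Seed L} {i : Site d}
    (h : ¬ Alive ε n y i) (hV : ∀ j, latticeDist j i ≤ n → j ∈ V) (x x' : Site d → Spin L) :
    run ε V n y x i = run ε Set.univ n y x' i := by
  induction n generalizing y i with
  | zero => exact absurd trivial h
  | succ n ih =>
    simp only [Alive, not_or, not_and, not_exists] at h
    have hi : i ∈ V := hV i (by simp [latticeDist_self])
    have key : ∀ j ∈ insert i (neighbours i), ¬ Alive ε n (tailSlices y) j →
        run ε V n (tailSlices y) x j = run ε Set.univ n (tailSlices y) x' j := fun j hj ha =>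
      ih ha fun l hl => hV l (latticeDist_le_succ_of_mem hj hl)
    by_cases ha : IsActive (coins (headSlice y)) i
    · by_cases hu : sureAcceptance ε L < (headSlice y i).2.2.1
      · have h2 := fun j hj => key j hj (h.2 hu j hj)
        refine sweep_congr ?_ rfl (h2 i (Finset.mem_insert_self _ _))
        rw [acceptance_congr _ fun j hj => h2 j (Finset.mem_insert_of_mem hj)]
        simp [hi]
      -- Both dynamics accept the proposal, whatever their configurations.
      · have hacc := fun x => (not_lt.1 hu).trans (exp_le_acceptance i x (headSlice y i).2.1)
        rw [run, run, sweep, sweep, if_pos ⟨hi, ha, hacc _⟩, if_pos ⟨Set.mem_univ i, ha, hacc _⟩]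
    · exact sweep_congr (by simp [ha]) rfl (key i (Finset.mem_insert_self _ _) (h.1 ha))

/-- The witness is the configuration that the longer run reaches at time `-m`. -/
theorem exists_run_add (V : Set (Site d)) (m k : ℕ) (y : Site d → ℕ → Seed L)
    (x : Site d → Spin L) : ∃ x', run ε V (m + k) y x = run ε V m y x' := by
  induction m generalizing y with
  | zero => exact ⟨run ε V k y x, by simp [run]⟩
  | succ m ih =>
    obtain ⟨x', hx'⟩ := ih (tailSlices y)
    exact ⟨x', by rw [Nat.succ_add, run, hx', run]⟩

theorem alive_congr {n : ℕ} {y y' : Site d → ℕ → Seed L} {i : Site d}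
    (h : ∀ j, latticeDist j i ≤ n → y' j = y j) : Alive ε n y' i ↔ Alive ε n y i := by
  induction n generalizing y y' i with
  | zero => rfl
  | succ n ih =>
    have h0 : ∀ j ∈ insert i (neighbours i), y' j = y j := fun j hj =>
      h j (latticeDist_le_succ_of_mem hj (by simp [latticeDist_self]))
    have h1 : ∀ j ∈ insert i (neighbours i),
        (Alive ε n (tailSlices y') j ↔ Alive ε n (tailSlices y) j) := fun j hj =>
      ih fun l hl => by
        ext1 t
        simp only [tailSlices, h l (latticeDist_le_succ_of_mem hj hl)]
    have hi := Finset.mem_insert_self i (neighbours i)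
    have h2 : IsActive (coins (headSlice y')) i ↔ IsActive (coins (headSlice y)) i :=
      isActive_congr fun j hj => by simp only [coins, headSlice, h0 j hj]
    simp only [Alive]
    rw [h1 i hi, h2, show headSlice y' i = headSlice y i by simp only [headSlice, h0 i hi]]
    refine or_congr Iff.rfl (and_congr Iff.rfl (exists_congr fun j => and_congr_right fun hj => ?_))
    exact h1 j hj

theorem run_congr {n : ℕ} {y y' : Site d → ℕ → Seed L} {i : Site d} (x : Site d → Spin L)
    (h : ∀ j, latticeDist j i ≤ n → y' j = y j) :
    run ε Set.univ n y' x i = run ε Set.univ n y x i := by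
  induction n generalizing y y' i with
  | zero => rfl
  | succ n ih =>
    have h0 : ∀ j ∈ insert i (neighbours i), y' j = y j := fun j hj =>
      h j (latticeDist_le_succ_of_mem hj (by simp [latticeDist_self]))
    have h1 : ∀ j ∈ insert i (neighbours i), run ε Set.univ n (tailSlices y') x j =
        run ε Set.univ n (tailSlices y) x j := fun j hj =>
      ih fun l hl => by
        ext1 t
        simp only [tailSlices, h l (latticeDist_le_succ_of_mem hj hl)]
    have hi := Finset.mem_insert_self i (neighbours i)
    have h2 : IsActive (coins (headSlice y')) i ↔ IsActive (coins (headSlice y)) i :=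
      isActive_congr fun j hj => by simp only [coins, headSlice, h0 j hj]
    have h3 : headSlice y' i = headSlice y i := by simp only [headSlice, h0 i hi]
    refine sweep_congr ?_ (by rw [h3]) (h1 i hi)
    rw [h2, h3, acceptance_congr _ fun j hj => h1 j (Finset.mem_insert_of_mem hj)]

/-! #### Equivariance -/

theorem isActive_shift (k i : Site d) (c : Site d → Bool) :
    IsActive (shiftConfig k c) i ↔ IsActive c (k + i) := by
  simp only [IsActive, shiftConfig, neighbours_add, Finset.forall_mem_image]

theorem acceptance_shift (k i : Site d) (x : Site d → Spin L) (z : Spin L) :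
    acceptance ε i (shiftConfig k x) z = acceptance ε (k + i) x z := by
  simp only [acceptance, localField, shiftConfig, add_assoc, add_sub_assoc]

theorem run_shift (k : Site d) (n : ℕ) (y : Site d → ℕ → Seed L) (x : Site d → Spin L) :
    run ε Set.univ n (shiftConfig k y) (shiftConfig k x) =
      shiftConfig k (run ε Set.univ n y x) := by
  induction n generalizing y with
  | zero => rfl
  | succ n ih =>
    have h1 : tailSlices (shiftConfig k y) = shiftConfig k (tailSlices y) := rfl
    have h2 : coins (headSlice (shiftConfig k y)) = shiftConfig k (coins (headSlice y)) := rfl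
    have h3 : ∀ i, headSlice (shiftConfig k y) i = headSlice y (k + i) := fun _ => rfl
    ext1 i
    rw [run, h1, ih]
    exact sweep_congr (by rw [h2, isActive_shift, acceptance_shift, h3]; simp) rfl rfl

theorem alive_shift (k i : Site d) (n : ℕ) (y : Site d → ℕ → Seed L) :
    Alive ε n (shiftConfig k y) i ↔ Alive ε n y (k + i) := by
  induction n generalizing y i with
  | zero => rfl
  | succ n ih =>
    have h1 : tailSlices (shiftConfig k y) = shiftConfig k (tailSlices y) := rfl
    have h2 : coins (headSlice (shiftConfig k y)) = shiftConfig k (coins (headSlice y)) := rfl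
    have h3 : ∀ i, headSlice (shiftConfig k y) i = headSlice y (k + i) := fun _ => rfl
    simp only [Alive, h1, ih, h2, isActive_shift, h3, neighbours_add, Finset.mem_insert,
      Finset.mem_image, exists_eq_or_imp, exists_exists_and_eq_and]

/-! #### Measurability -/

theorem measurable_run (V : Set (Site d)) (n : ℕ) :
    Measurable fun p : (Site d → ℕ → Seed L) × (Site d → Spin L) => run ε V n p.1 p.2 := by
  induction n with
  | zero => exact measurable_snd
  | succ n ih =>
    have h1 : Measurable fun p : (Site d → ℕ → Seed L) × (Site d → Spin L) =>
        (tailSlices p.1, p.2) := (measurable_tailSlices.comp measurable_fst).prodMk measurable_snd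
    have h2 : Measurable fun p : (Site d → ℕ → Seed L) × (Site d → Spin L) => headSlice p.1 :=
      measurable_headSlice.comp measurable_fst
    exact (measurable_sweep V).comp (h2.prodMk (ih.comp h1))

theorem measurableSet_alive (n : ℕ) (i : Site d) :
    MeasurableSet {y : Site d → ℕ → Seed L | Alive ε n y i} := by
  induction n generalizing i with
  | zero => exact MeasurableSet.univ
  | succ n ih =>
    have h1 : MeasurableSet {y : Site d → ℕ → Seed L | IsActive (coins (headSlice y)) i} :=
      (measurable_coins.comp measurable_headSlice) (measurableSet_isActive i)
    have h2 : ∀ j, MeasurableSet {y : Site d → ℕ → Seed L | Alive ε n (tailSlices y) j} :=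
      fun j => measurable_tailSlices (ih j)
    have h3 : MeasurableSet {y : Site d → ℕ → Seed L |
        sureAcceptance ε L < (headSlice y i).2.2.1} :=
      measurableSet_lt measurable_const (by unfold headSlice; fun_prop)
    have h4 : {y : Site d → ℕ → Seed L | Alive ε (n + 1) y i} =
        ({y | IsActive (coins (headSlice y)) i}ᶜ ∩ {y | Alive ε n (tailSlices y) i}) ∪
        ({y | sureAcceptance ε L < (headSlice y i).2.2.1} ∩
          ⋃ j ∈ insert i (neighbours i), {y | Alive ε n (tailSlices y) j}) := by
      ext y
      simp [Alive]
    rw [h4]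
    exact (h1.compl.inter (h2 i)).union
      (h3.inter (Finset.measurableSet_biUnion _ fun j _ => h2 j))

end

/-! #### The coding -/

theorem exists_not_alive_or_forall_alive {d : ℕ} {L : ℝ} (ε : ℝ) (y : Site d → ℕ → Seed L)
    (i : Site d) : ∃ n, ¬ Alive ε n y i ∨ ∀ m, Alive ε m y i := by
  by_cases h : ∃ n, ¬ Alive ε n y i
  · exact h.imp fun _ => Or.inl
  · exact ⟨0, Or.inr (not_exists_not.1 h)⟩

open Classical in
/-- The dynamics in the whole lattice started in the infinite past. At a site whose spin depends
on arbitrarily remote times, which almost surely does not happen, it takes a fixed value. -/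
def pastCoding {d : ℕ} {L : ℝ} (ε : ℝ) (s : Spin L) (y : Site d → ℕ → Seed L) :
    Site d → Spin L := fun i =>
  run ε Set.univ (Nat.find (exists_not_alive_or_forall_alive ε y i)) y (fun _ => s) i

section
variable {d : ℕ} {L : ℝ} {ε : ℝ} {s : Spin L}

/-- The coding starts at the first depth `m ≤ n` where `Alive` fails. A run from time `-n` is a run
from time `-m` with another starting configuration, which does not matter at `i`. -/
theorem pastCoding_eq_run {n : ℕ} {y : Site d → ℕ → Seed L} {i : Site d}
    (h : ¬ Alive ε n y i) (x : Site d → Spin L) :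
    pastCoding ε s y i = run ε Set.univ n y x i := by
  classical
  have hspec := Nat.find_spec (exists_not_alive_or_forall_alive ε y i)
  have hle := Nat.find_min' (exists_not_alive_or_forall_alive ε y i) (Or.inl h : _ ∨ _)
  obtain ⟨k, hk⟩ := Nat.exists_eq_add_of_le hle
  have hm := hspec.resolve_right fun h2 => h (h2 n)
  obtain ⟨x', hx'⟩ := exists_run_add (ε := ε) Set.univ
    (Nat.find (exists_not_alive_or_forall_alive ε y i)) k y x
  rw [pastCoding, hk, hx']
  exact run_eq_of_not_alive hm (fun _ _ => Set.mem_univ _) _ _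

theorem pastCoding_eq_of_forall_alive {y : Site d → ℕ → Seed L} {i : Site d}
    (h : ∀ n, Alive ε n y i) : pastCoding ε s y i = s := by
  classical
  have : Nat.find (exists_not_alive_or_forall_alive ε y i) = 0 :=
    (Nat.find_eq_zero _).2 (Or.inr h)
  rw [pastCoding, this]
  rfl

theorem pastCoding_shift (k : Site d) (y : Site d → ℕ → Seed L) :
    pastCoding ε s (shiftConfig k y) = shiftConfig k (pastCoding ε s y) := by
  ext1 i
  change _ = pastCoding ε s y (k + i)
  by_cases h : ∃ n, ¬ Alive ε n y (k + i)
  · obtain ⟨n, hn⟩ := h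
    rw [pastCoding_eq_run hn fun _ => s,
      pastCoding_eq_run (mt (alive_shift k i n y).1 hn) (shiftConfig k fun _ => s), run_shift]
    rfl
  · have h' := not_exists_not.1 h
    rw [pastCoding_eq_of_forall_alive h',
      pastCoding_eq_of_forall_alive fun n => (alive_shift k i n y).2 (h' n)]

theorem measurable_pastCoding : Measurable (pastCoding (d := d) (L := L) ε s) := by
  classical
  refine measurable_pi_iff.2 fun i => ?_
  refine Measurable.find (f := fun n y => run ε Set.univ n y (fun _ => s) i)
    (p := fun n (y : Site d → ℕ → Seed L) => ¬ Alive ε n y i ∨ ∀ m, Alive ε m y i)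
    (fun n => ?_) (fun n => ?_) (fun y => exists_not_alive_or_forall_alive ε y i)
  · exact (measurable_pi_apply i).comp ((measurable_run Set.univ n).comp measurable_prodMk_right)
  · have h : {y : Site d → ℕ → Seed L | ¬ Alive ε n y i ∨ ∀ m, Alive ε m y i} =
        {y | Alive ε n y i}ᶜ ∪ ⋂ m, {y | Alive ε m y i} := by
      ext y
      simp
    rw [h]
    exact (measurableSet_alive n i).compl.union
      (MeasurableSet.iInter fun m => measurableSet_alive m i)

/-- Influence travels one lattice step per time step: both the failure of `Alive` at depth `n` and
the resulting spin are read off the seeds in the ball of radius `n`. -/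
theorem codingRadius_pastCoding_le {n : ℕ} {y : Site d → ℕ → Seed L} {i : Site d}
    (h : ¬ Alive ε n y i) : codingRadius (pastCoding ε s) i y ≤ n := by
  refine iInf₂_le n fun y' hy' => ?_
  rw [pastCoding_eq_run h fun _ => s, pastCoding_eq_run (mt (alive_congr hy').1 h) fun _ => s,
    run_congr _ hy']

end

/-! ### Survival probabilities -/

/-- An upper bound for the mean number of offspring of the exploration of the past. -/
def survivalRate (d : ℕ) (L ε : ℝ) : ENNReal :=
  (1 - 2⁻¹ ^ (2 * d + 1)) + (2 * d + 1 : ℕ) * ENNReal.ofReal (1 - sureAcceptance ε L)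

section
variable {d : ℕ} {L : ℝ} {ε : ℝ}

theorem sureAcceptance_mem (ε L : ℝ) : sureAcceptance ε L ∈ unitInterval := by
  refine ⟨(Real.exp_pos _).le, ?_⟩
  rw [sureAcceptance, Real.exp_le_one_iff]
  have : 0 ≤ |ε| * L ^ 2 := by positivity
  linarith

theorem card_insert_neighbours_le (i : Site d) : (insert i (neighbours i)).card ≤ 2 * d + 1 :=
  (Finset.card_insert_le _ _).trans (by have := card_neighbours_le i; omega)

/-- Activity prescribes the independent fair coins of at most `2d + 1` sites. -/
theorem infinitePi_isActive_ge [Fact (0 < L)] (i : Site d) :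
    2⁻¹ ^ (2 * d + 1) ≤
      Measure.infinitePi (fun _ : Site d => seedMeasure L) {ω | IsActive (coins ω) i} := by
  classical
  have hset : {ω : Site d → Seed L | IsActive (coins ω) i} =
      ((insert i (neighbours i) : Finset (Site d)) : Set (Site d)).pi
        (fun j => {decide (j = i)} ×ˢ (Set.univ : Set (Proposal L))) := by
    ext ω
    have hne : ∀ j ∈ neighbours i, j ≠ i := fun j hj h => self_notMem_neighbours i (h ▸ hj)
    simp only [IsActive, coins, Set.mem_ofPred_eq, Set.mem_pi, Finset.mem_coe, Set.mem_prod,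
      Set.mem_singleton_iff, Set.mem_univ, and_true, Finset.forall_mem_insert, decide_true]
    refine and_congr_right fun _ => forall₂_congr fun j hj => ?_
    simp [hne j hj]
  have hval : ∀ j : Site d, seedMeasure L ({decide (j = i)} ×ˢ Set.univ) = 2⁻¹ := fun j => by
    rw [seedMeasure, Measure.prod_prod, coinMeasure_singleton]
    simp
  rw [hset, Measure.infinitePi_pi _ fun j _ => (measurableSet_singleton _).prod MeasurableSet.univ]
  simp only [hval, Finset.prod_const]
  exact pow_le_pow_right_of_le_one' (by simp) (card_insert_neighbours_le i)

theorem infinitePi_sureAcceptance_lt [Fact (0 < L)] (i : Site d) :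
    Measure.infinitePi (fun _ : Site d => seedMeasure L)
      {ω | sureAcceptance ε L < (ω i).2.2.1} = ENNReal.ofReal (1 - sureAcceptance ε L) := by
  have hm : MeasurableSet {w : Seed L | sureAcceptance ε L < w.2.2.1} :=
    measurableSet_lt measurable_const (by fun_prop)
  have h1 := (measurePreserving_eval_infinitePi
    (fun _ : Site d => seedMeasure L) i).measure_preimage hm.nullMeasurableSet
  refine h1.trans ?_
  have h2 : {w : Seed L | sureAcceptance ε L < w.2.2.1} = Set.univ ×ˢ (Set.univ ×ˢ
      Set.Ioi (⟨sureAcceptance ε L, sureAcceptance_mem ε L⟩ : unitInterval)) := by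
    ext w
    simp [← Subtype.coe_lt_coe]
  rw [h2, seedMeasure, Measure.prod_prod, proposalMeasure, Measure.prod_prod, measure_univ,
    measure_univ, one_mul, one_mul, unitInterval.volume_Ioi]

/-- One step of the branching bound: survival requires either inactivity and survival at `i`, or an
uncertain acceptance and survival at one of at most `2d + 1` sites. The first event of each pair
concerns the head slice, the second the independent tail, so a union bound suffices. -/
theorem measure_alive_le [Fact (0 < L)] (n : ℕ) (i : Site d) :
    spaceTimeMeasure (Site d) (seedMeasure L) {y | Alive ε n y i} ≤ survivalRate d L ε ^ n := by
  induction n generalizing i with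
  | zero => simpa using prob_le_one
  | succ n ih =>
    set Q := Measure.infinitePi (fun _ : Site d => seedMeasure L)
    set P := spaceTimeMeasure (Site d) (seedMeasure L)
    have hact : MeasurableSet {ω : Site d → Seed L | IsActive (coins ω) i} :=
      measurable_coins (measurableSet_isActive i)
    have hsub : {y : Site d → ℕ → Seed L | Alive ε (n + 1) y i} ⊆
        (fun y => (headSlice y, tailSlices y)) ⁻¹'
          ({ω | IsActive (coins ω) i}ᶜ ×ˢ {y | Alive ε n y i} ∪
            ⋃ j ∈ insert i (neighbours i),
              {ω | sureAcceptance ε L < (ω i).2.2.1} ×ˢ {y | Alive ε n y j}) := by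
      intro y hy
      rcases hy with hy | ⟨h1, j, hj, h2⟩
      · exact Or.inl hy
      · exact Or.inr (Set.mem_biUnion (by exact hj) ⟨h1, h2⟩)
    have hmeas : MeasurableSet ({ω | IsActive (coins ω) i}ᶜ ×ˢ {y | Alive ε n y i} ∪
        ⋃ j ∈ insert i (neighbours i),
          {ω : Site d → Seed L | sureAcceptance ε L < (ω i).2.2.1} ×ˢ
            {y : Site d → ℕ → Seed L | Alive ε n y j}) := by
      refine (hact.compl.prod (measurableSet_alive n i)).union
        (Finset.measurableSet_biUnion _ fun j _ => MeasurableSet.prod ?_ (measurableSet_alive n j))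
      exact measurableSet_lt measurable_const (by fun_prop)
    calc P {y | Alive ε (n + 1) y i}
        ≤ Q.prod P ({ω | IsActive (coins ω) i}ᶜ ×ˢ {y | Alive ε n y i} ∪
            ⋃ j ∈ insert i (neighbours i),
              {ω | sureAcceptance ε L < (ω i).2.2.1} ×ˢ {y | Alive ε n y j}) := by
          rw [← (measurePreserving_headSlice_tailSlices (Site d) (seedMeasure L)).measure_preimage
            hmeas.nullMeasurableSet]
          exact measure_mono hsub
      _ ≤ Q {ω | IsActive (coins ω) i}ᶜ * P {y | Alive ε n y i} +
            ∑ j ∈ insert i (neighbours i),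
              Q {ω | sureAcceptance ε L < (ω i).2.2.1} * P {y | Alive ε n y j} := by
          refine (measure_union_le _ _).trans (add_le_add (Measure.prod_prod _ _).le ?_)
          refine (measure_biUnion_finset_le _ _).trans (Finset.sum_le_sum fun j _ => ?_)
          exact (Measure.prod_prod _ _).le
      _ ≤ (1 - 2⁻¹ ^ (2 * d + 1)) * survivalRate d L ε ^ n +
            ∑ j ∈ insert i (neighbours i),
              ENNReal.ofReal (1 - sureAcceptance ε L) * survivalRate d L ε ^ n := by
          refine add_le_add (mul_le_mul' ?_ (ih i)) (Finset.sum_le_sum fun j _ =>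
            mul_le_mul' (infinitePi_sureAcceptance_lt i).le (ih j))
          rw [prob_compl_eq_one_sub hact]
          exact tsub_le_tsub_left (infinitePi_isActive_ge i) 1
      _ ≤ survivalRate d L ε ^ (n + 1) := by
          rw [Finset.sum_const, nsmul_eq_mul, ← mul_assoc, ← add_mul,
            pow_succ' (survivalRate d L ε)]
          exact mul_le_mul' (add_le_add le_rfl (mul_le_mul'
            (Nat.cast_le.2 (card_insert_neighbours_le i)) le_rfl)) le_rfl

theorem measure_exists_alive_le [Fact (0 < L)] (n : ℕ) (Δ : Finset (Site d)) :
    spaceTimeMeasure (Site d) (seedMeasure L) {y | ∃ i ∈ Δ, Alive ε n y i} ≤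
      Δ.card * survivalRate d L ε ^ n := by
  have : {y : Site d → ℕ → Seed L | ∃ i ∈ Δ, Alive ε n y i} = ⋃ i ∈ Δ, {y | Alive ε n y i} := by
    ext y
    simp
  rw [this]
  refine (measure_biUnion_finset_le _ _).trans ?_
  refine (Finset.sum_le_sum fun i _ => measure_alive_le n i).trans ?_
  simp

/-- By `1 - exp (-t) ≤ t` with `t = 2 |ε| L²`, the hypothesis makes the branching term smaller than
the gain `2^{-(2d+1)}` from activity. -/
theorem survivalRate_lt_one (hL : 0 < L)
    (h : |ε| < (1 / 2) ^ (2 * d + 1) / ((2 * d + 1) * (2 * L ^ 2))) :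
    survivalRate d L ε < 1 := by
  have h1 : 1 - sureAcceptance ε L ≤ 2 * (|ε| * L ^ 2) := by
    have := Real.add_one_le_exp (-(2 * (|ε| * L ^ 2)))
    rw [sureAcceptance]
    linarith
  have h2 : (2 * d + 1 : ℝ) * (1 - sureAcceptance ε L) < (1 / 2) ^ (2 * d + 1) := by
    rw [lt_div_iff₀ (by positivity)] at h
    calc (2 * d + 1 : ℝ) * (1 - sureAcceptance ε L)
        ≤ (2 * d + 1 : ℝ) * (2 * (|ε| * L ^ 2)) := by gcongr
      _ = |ε| * ((2 * d + 1) * (2 * L ^ 2)) := by ring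
      _ < _ := h
  have hq : (2⁻¹ : ENNReal) ^ (2 * d + 1) = ENNReal.ofReal ((1 / 2) ^ (2 * d + 1)) := by
    rw [ENNReal.ofReal_pow (by norm_num), one_div, ENNReal.ofReal_inv_of_pos (by norm_num)]
    simp
  have hq1 : (2⁻¹ : ENNReal) ^ (2 * d + 1) ≤ 1 := pow_le_one' (by simp) _
  have h3 : ((2 * d + 1 : ℕ) : ENNReal) * ENNReal.ofReal (1 - sureAcceptance ε L) <
      2⁻¹ ^ (2 * d + 1) := by
    rw [hq, ← ENNReal.ofReal_natCast, ← ENNReal.ofReal_mul (by positivity),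
      ENNReal.ofReal_lt_ofReal_iff (by positivity)]
    push_cast
    exact h2
  calc survivalRate d L ε < (1 - 2⁻¹ ^ (2 * d + 1)) + 2⁻¹ ^ (2 * d + 1) :=
        ENNReal.add_lt_add_left (ne_top_of_le_ne_top ENNReal.one_ne_top tsub_le_self) h3
    _ = 1 := tsub_add_cancel_of_le hq1

/-! ### Comparison of invariant measures with the coding -/

/-- Stationarity over `n` steps: the earlier slices are independent of the last one and preserve `μ`
by induction, then the last sweep preserves it. -/
theorem lintegral_run [Fact (0 < L)] {μ : Measure (Site d → Spin L)} [SFinite μ]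
    (V : Finset (Site d)) (h : ∀ i ∈ V, IsSpecInvariant ε {i} μ) (n : ℕ)
    {f : (Site d → Spin L) → ENNReal} (hf : Measurable f) :
    ∫⁻ y, ∫⁻ x, f (run ε V n y x) ∂μ ∂spaceTimeMeasure (Site d) (seedMeasure L) =
      ∫⁻ x, f x ∂μ := by
  induction n generalizing f with
  | zero => simp [run]
  | succ n ih =>
    have hr : Measurable fun q : ((Site d → Seed L) × (Site d → ℕ → Seed L)) ×
        (Site d → Spin L) => run ε V n q.1.2 q.2 :=
      (measurable_run (L := L) (ε := ε) (V : Set (Site d)) n).comp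
        ((measurable_snd.comp measurable_fst).prodMk measurable_snd)
    have hm : Measurable fun q : ((Site d → Seed L) × (Site d → ℕ → Seed L)) ×
        (Site d → Spin L) => f (sweep ε V q.1.1 (run ε V n q.1.2 q.2)) :=
      hf.comp ((measurable_sweep (L := L) (ε := ε) (V : Set (Site d))).comp
        ((measurable_fst.comp measurable_fst).prodMk hr))
    have hi : Measurable fun q : (Site d → Seed L) × (Site d → ℕ → Seed L) =>
        ∫⁻ x, f (sweep ε V q.1 (run ε V n q.2 x)) ∂μ := hm.lintegral_prod_right'
    refine ((measurePreserving_headSlice_tailSlices (Site d) (seedMeasure L)).lintegral_comp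
      hi).trans ?_
    rw [lintegral_prod _ hi.aemeasurable]
    have h2 : ∀ ω : Site d → Seed L, ∫⁻ y, ∫⁻ x, f (sweep ε V ω (run ε V n y x)) ∂μ
        ∂spaceTimeMeasure (Site d) (seedMeasure L) = ∫⁻ x, f (sweep ε V ω x) ∂μ := fun ω =>
      ih (f := fun x => f (sweep ε V ω x)) (hf.comp
        ((measurable_sweep (L := L) (ε := ε) (V : Set (Site d))).comp measurable_prodMk_left))
    simp only [h2]
    rw [lintegral_sweep V h (f := fun q => f q.2) (hf.comp measurable_snd)]
    simp

theorem run_eq_pastCoding_of_not_alive {V : Set (Site d)} {n : ℕ} {s : Spin L}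
    {y : Site d → ℕ → Seed L} {i : Site d} (h : ¬ Alive ε n y i)
    (hV : ∀ j, latticeDist j i ≤ n → j ∈ V) (x : Site d → Spin L) :
    run ε V n y x i = pastCoding ε s y i := by
  rw [pastCoding_eq_run h x, run_eq_of_not_alive h hV x x]

/-- By stationarity `μ` is the law of the run in `V` started from `μ`. On `Δ` this run coincides
with the coding unless some site of `Δ` is still alive at depth `n`, and there `f ≤ 1` bounds the
error. -/
theorem lintegral_compare [Fact (0 < L)] {μ : Measure (Site d → Spin L)}
    [IsProbabilityMeasure μ] {V : Finset (Site d)} (h : ∀ i ∈ V, IsSpecInvariant ε {i} μ)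
    {Δ : Finset (Site d)} {n : ℕ} (hV : ∀ i ∈ Δ, ∀ j, latticeDist j i ≤ n → j ∈ V)
    {f : (Site d → Spin L) → ENNReal} (hf : Measurable f) (hf1 : ∀ x, f x ≤ 1)
    (hfΔ : DependsOn f Δ) (s : Spin L) :
    ∫⁻ x, f x ∂μ ≤ ∫⁻ y, f (pastCoding ε s y) ∂spaceTimeMeasure (Site d) (seedMeasure L) +
        Δ.card * survivalRate d L ε ^ n ∧
      ∫⁻ y, f (pastCoding ε s y) ∂spaceTimeMeasure (Site d) (seedMeasure L) ≤
        ∫⁻ x, f x ∂μ + Δ.card * survivalRate d L ε ^ n := by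
  classical
  set E : Set (Site d → ℕ → Seed L) := {y | ∃ i ∈ Δ, Alive ε n y i} with hE
  have hEm : MeasurableSet E := by
    have : E = ⋃ i ∈ Δ, {y | Alive ε n y i} := by
      ext y
      simp [hE]
    rw [this]
    exact Finset.measurableSet_biUnion _ fun i _ => measurableSet_alive n i
  have heq : ∀ y ∉ E, ∀ x, f (run ε V n y x) = f (pastCoding ε s y) := fun y hy x =>
    hfΔ fun i hi => run_eq_pastCoding_of_not_alive (fun ha => hy ⟨i, hi, ha⟩) (hV i hi) x
  have hFm : Measurable fun y : Site d → ℕ → Seed L => f (pastCoding ε s y) :=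
    hf.comp measurable_pastCoding
  have hRm : Measurable fun y : Site d → ℕ → Seed L => ∫⁻ x, f (run ε V n y x) ∂μ :=
    (hf.comp (measurable_run (L := L) (ε := ε) (V : Set (Site d)) n)).lintegral_prod_right'
  have hEle : ∫⁻ y, E.indicator 1 y ∂spaceTimeMeasure (Site d) (seedMeasure L) ≤
      Δ.card * survivalRate d L ε ^ n := by
    rw [lintegral_indicator_one hEm]
    exact measure_exists_alive_le n Δ
  rw [← lintegral_run V h n hf]
  constructor
  · refine le_trans ?_ (add_le_add_right hEle _)
    rw [← lintegral_add_left hFm]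
    refine lintegral_mono fun y => ?_
    by_cases hy : y ∈ E
    · calc ∫⁻ x, f (run ε V n y x) ∂μ ≤ ∫⁻ _, 1 ∂μ := lintegral_mono fun x => hf1 _
        _ ≤ _ := by simp [hy]
    · simp [heq y hy]
  · refine le_trans ?_ (add_le_add_right hEle _)
    rw [← lintegral_add_left hRm]
    refine lintegral_mono fun y => ?_
    by_cases hy : y ∈ E
    · exact (hf1 _).trans (by simp [hy])
    · simp [heq y hy]

theorem le_of_forall_le_add_mul_pow {a b C r : ENNReal} (hC : C ≠ ⊤) (hr : r < 1)
    (h : ∀ n : ℕ, a ≤ b + C * r ^ n) : a ≤ b := by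
  have h1 : Filter.Tendsto (fun n : ℕ => b + C * r ^ n) Filter.atTop (nhds (b + C * 0)) :=
    (ENNReal.Tendsto.const_mul (ENNReal.tendsto_pow_atTop_nhds_zero_of_lt_one hr)
      (Or.inr hC)).const_add b
  rw [mul_zero, add_zero] at h1
  exact ge_of_tendsto' h1 h

/-- The law of the coding. -/
def pastLaw (d : ℕ) (L ε : ℝ) [Fact (0 < L)] (s : Spin L) : Measure (Site d → Spin L) :=
  (spaceTimeMeasure (Site d) (seedMeasure L)).map (pastCoding ε s)

instance (L ε : ℝ) [Fact (0 < L)] (s : Spin L) : IsProbabilityMeasure (pastLaw d L ε s) :=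
  Measure.isProbabilityMeasure_map measurable_pastCoding.aemeasurable

/-! ### The law of the coding as the unique Gibbs measure -/

theorem measure_ext_of_cylinder {ι : Type*} {X : ι → Type*} [∀ i, MeasurableSpace (X i)]
    {μ ν : Measure (∀ i, X i)} [IsFiniteMeasure μ]
    (h : ∀ (Δ : Finset ι) (A : Set (∀ i : Δ, X i)), MeasurableSet A →
      μ (cylinder Δ A) = ν (cylinder Δ A)) : μ = ν := by
  refine ext_of_generate_finite _ generateFrom_measurableCylinders.symm
    isPiSystem_measurableCylinders (fun s hs => ?_) ?_
  · obtain ⟨Δ, A, hA, rfl⟩ := (mem_measurableCylinders _).1 hs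
    exact h Δ A hA
  · simpa using h ∅ Set.univ MeasurableSet.univ

theorem dependsOn_indicator_cylinder {ι : Type*} {X : ι → Type*} (Δ : Finset ι)
    (A : Set (∀ i : Δ, X i)) :
    DependsOn ((cylinder Δ A).indicator (1 : (∀ i, X i) → ENNReal)) Δ := by
  intro x y hxy
  have : Δ.restrict x = Δ.restrict y := funext fun i => hxy i i.2
  have h2 : x ∈ cylinder Δ A ↔ y ∈ cylinder Δ A := by rw [mem_cylinder, mem_cylinder, this]
  by_cases hx : x ∈ cylinder Δ A
  · rw [Set.indicator_of_mem hx, Set.indicator_of_mem (h2.1 hx)]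
    rfl
  · rw [Set.indicator_of_notMem hx, Set.indicator_of_notMem (mt h2.2 hx)]

theorem hamiltonian_congr {Λ : Finset (Site d)} {x y : Site d → ℝ}
    (h : ∀ i ∈ Λ ∪ Λ.biUnion neighbours, x i = y i) :
    hamiltonian ε Λ x = hamiltonian ε Λ y := by
  have h1 : ∀ i ∈ Λ, x i = y i := fun i hi => h i (Finset.mem_union_left _ hi)
  have h2 : ∀ i ∈ Λ, ∀ j ∈ neighbours i, x j = y j := fun i hi j hj =>
    h j (Finset.mem_union_right _ (Finset.mem_biUnion.2 ⟨i, hi, hj⟩))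
  unfold hamiltonian
  congr 2
  · exact Finset.sum_congr rfl fun i hi => by rw [h1 i hi]
  · refine Finset.sum_congr rfl fun k _ => Finset.sum_congr rfl fun i hi => ?_
    rcases Finset.mem_union.1 hi with hi | hi
    · rw [h1 i hi, h2 i hi _ (mem_neighbours.2 ⟨k, Or.inl rfl⟩)]
    · obtain ⟨j, hj, rfl⟩ := Finset.mem_image.1 hi
      rw [sub_add_cancel, h1 j hj, h2 j hj _ (mem_neighbours.2 ⟨k, Or.inr rfl⟩)]

/-- The interaction has finite range, so averaging over `Λ` keeps a local function local and
`lintegral_compare` applies to it. -/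
theorem dependsOn_specIntegral {Λ Δ : Finset (Site d)} {f : (Site d → Spin L) → ENNReal}
    (hf : DependsOn f Δ) :
    DependsOn (specIntegral ε Λ f) ((Δ ∪ (Λ ∪ Λ.biUnion neighbours) : Finset (Site d))) := by
  have key : ∀ {g : (Site d → Spin L) → ENNReal}, DependsOn g Δ →
      DependsOn (weightedIntegral ε Λ g) ((Δ ∪ (Λ ∪ Λ.biUnion neighbours) : Finset (Site d))) := by
    intro g hg ξ η h
    refine lintegral_congr fun x => ?_
    have hx : ∀ i ∈ Δ ∪ (Λ ∪ Λ.biUnion neighbours),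
        Function.updateFinset ξ Λ x i = Function.updateFinset η Λ x i := fun i hi => by
      simp only [Function.updateFinset, h i hi]
    change boltzmann ε Λ _ * g _ = boltzmann ε Λ _ * g _
    rw [hg fun i hi => hx i (Finset.mem_union_left _ hi), boltzmann, boltzmann,
      hamiltonian_congr fun i hi => by rw [hx i (Finset.mem_union_right _ hi)]]
  intro ξ η h
  rw [specIntegral, specIntegral, key hf h, key (g := 1) (fun _ _ _ => rfl) h]

/-- Under a finite-volume Gibbs law in a large box, `f` and `specIntegral ε Λ f` have equal
integrals. Both are local, so both integrals are close to those under the law of the coding; letting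
the box grow gives equality. -/
theorem isSpecInvariant_pastLaw [hL : Fact (0 < L)] (hr : survivalRate d L ε < 1) (s : Spin L)
    (Λ : Finset (Site d)) : IsSpecInvariant ε Λ (pastLaw d L ε s) := by
  classical
  refine (measure_ext_of_cylinder fun Δ A hA => ?_).symm
  have hE : MeasurableSet (cylinder (α := fun _ : Site d => Spin L) Δ A) := .cylinder Δ hA
  set f : (Site d → Spin L) → ENNReal := (cylinder Δ A).indicator 1 with hf
  have hfm : Measurable f := measurable_one.indicator hE
  have hf1 : ∀ x, f x ≤ 1 := fun x => Set.indicator_le_self' (fun _ _ => zero_le) x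
  have hg1 : ∀ ξ, specIntegral ε Λ f ξ ≤ 1 := fun ξ => by
    have := isProbabilityMeasure_gibbsKernel (ε := ε) hL.out Λ ξ
    rw [hf, ← gibbsKernel_apply hL.out Λ ξ hE]
    exact prob_le_one
  set Δ' := Δ ∪ (Λ ∪ Λ.biUnion neighbours) with hΔ'
  have hfΔ : DependsOn f Δ' := fun x y h => dependsOn_indicator_cylinder Δ A fun i hi =>
    h i (Finset.mem_coe.2 (Finset.mem_union_left _ hi))
  have hgΔ : DependsOn (specIntegral ε Λ f) Δ' :=
    dependsOn_specIntegral (dependsOn_indicator_cylinder (X := fun _ : Site d => Spin L) Δ A)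
  have hgm := measurable_specIntegral (ε := ε) Λ hfm
  rw [Measure.bind_apply hE (measurable_gibbsKernel hL.out Λ).aemeasurable]
  simp only [gibbsKernel_apply hL.out Λ _ hE]
  rw [← lintegral_indicator_one hE, pastLaw, lintegral_map hfm measurable_pastCoding,
    lintegral_map hgm measurable_pastCoding]
  -- The comparison law is the Gibbs law in a box around `Δ'`, with boundary condition constantly
  -- `s`.
  have hcmp : ∀ n : ℕ, ∃ μ : Measure (Site d → Spin L), IsProbabilityMeasure μ ∧
      IsSpecInvariant ε Λ μ ∧ ∃ V : Finset (Site d), (∀ i ∈ V, IsSpecInvariant ε {i} μ) ∧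
      ∀ i ∈ Δ', ∀ j, latticeDist j i ≤ n → j ∈ V := by
    intro n
    obtain ⟨V, hV⟩ := exists_finset_latticeDist_le Δ' n
    refine ⟨gibbsKernel ε V fun _ => s, isProbabilityMeasure_gibbsKernel hL.out V _,
      isSpecInvariant_gibbsKernel hL.out (fun i hi => ?_) _, V,
      fun i hi => isSpecInvariant_gibbsKernel hL.out (Finset.singleton_subset_iff.2 hi) _, hV⟩
    exact hV i (Finset.mem_union_right _ (Finset.mem_union_left _ hi)) i
      (by simp [latticeDist_self])
  have hC : (2 * Δ'.card : ENNReal) ≠ ⊤ := ENNReal.mul_ne_top (by simp) (by simp)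
  have h2 : ∀ n : ℕ, (2 * Δ'.card : ENNReal) * survivalRate d L ε ^ n =
      Δ'.card * survivalRate d L ε ^ n + Δ'.card * survivalRate d L ε ^ n := fun n => by ring
  refine le_antisymm (le_of_forall_le_add_mul_pow hC hr fun n => ?_)
    (le_of_forall_le_add_mul_pow hC hr fun n => ?_)
  · obtain ⟨μ, hμ, hinv, V, hVinv, hV⟩ := hcmp n
    have hinv' := hinv.lintegral_specIntegral hL.out hfm
    refine (lintegral_compare hVinv hV hfm hf1 hfΔ s).2.trans ?_
    rw [← hinv', h2, ← add_assoc]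
    exact add_le_add_left (lintegral_compare hVinv hV hgm hg1 hgΔ s).1 _
  · obtain ⟨μ, hμ, hinv, V, hVinv, hV⟩ := hcmp n
    have hinv' := hinv.lintegral_specIntegral hL.out hfm
    refine (lintegral_compare hVinv hV hgm hg1 hgΔ s).2.trans ?_
    rw [hinv', h2, ← add_assoc]
    exact add_le_add_left (lintegral_compare hVinv hV hfm hf1 hfΔ s).1 _

theorem isTruncatedGibbs_pastLaw [hL : Fact (0 < L)] (hr : survivalRate d L ε < 1) (s : Spin L) :
    IsTruncatedGibbs ε L (pastLaw d L ε s) :=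
  isTruncatedGibbs_of_isSpecInvariant hL.out (isSpecInvariant_pastLaw hr s)

/-- A Gibbs measure is invariant in every box, so the comparison error on a fixed window tends to
zero. -/
theorem IsTruncatedGibbs.eq_pastLaw [hL : Fact (0 < L)] (hr : survivalRate d L ε < 1)
    (s : Spin L) {μ : Measure (Site d → Spin L)} (h : IsTruncatedGibbs ε L μ) :
    μ = pastLaw d L ε s := by
  have := h.isProbabilityMeasure
  refine measure_ext_of_cylinder fun Δ A hA => ?_
  have hE : MeasurableSet (cylinder (α := fun _ : Site d => Spin L) Δ A) := .cylinder Δ hA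
  have hfm : Measurable ((cylinder Δ A).indicator (1 : (Site d → Spin L) → ENNReal)) :=
    measurable_one.indicator hE
  have hf1 : ∀ x, (cylinder Δ A).indicator (1 : (Site d → Spin L) → ENNReal) x ≤ 1 := fun x =>
    Set.indicator_le_self' (fun _ _ => zero_le) x
  rw [← lintegral_indicator_one hE, ← lintegral_indicator_one hE, pastLaw,
    lintegral_map hfm measurable_pastCoding]
  have hcmp : ∀ n : ℕ, ∃ V : Finset (Site d), ∀ i ∈ Δ, ∀ j, latticeDist j i ≤ n → j ∈ V :=
    exists_finset_latticeDist_le Δ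
  refine le_antisymm
    (le_of_forall_le_add_mul_pow (ENNReal.natCast_ne_top Δ.card) hr fun n => ?_)
    (le_of_forall_le_add_mul_pow (ENNReal.natCast_ne_top Δ.card) hr fun n => ?_)
  · obtain ⟨V, hV⟩ := hcmp n
    exact (lintegral_compare (fun i _ => h.isSpecInvariant hL.out {i}) hV hfm hf1
      (dependsOn_indicator_cylinder (X := fun _ : Site d => Spin L) Δ A) s).1
  · obtain ⟨V, hV⟩ := hcmp n
    exact (lintegral_compare (fun i _ => h.isSpecInvariant hL.out {i}) hV hfm hf1
      (dependsOn_indicator_cylinder (X := fun _ : Site d => Spin L) Δ A) s).2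

theorem isFFIIDWithExpTails_pastLaw [Fact (0 < L)] (hr : survivalRate d L ε < 1) (s : Spin L) :
    IsFFIIDWithExpTails (pastLaw d L ε s) := by
  have htail : ∀ n : ℕ, spaceTimeMeasure (Site d) (seedMeasure L)
      {y | ((n + 1 : ℕ) : ℕ∞) ≤ codingRadius (pastCoding ε s) 0 y} ≤ survivalRate d L ε ^ n := by
    intro n
    refine (measure_mono fun y hy => ?_).trans (measure_alive_le n (0 : Site d))
    by_contra h
    have := (show ((n + 1 : ℕ) : ℕ∞) ≤ _ from hy).trans (codingRadius_pastCoding_le h)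
    rw [Nat.cast_le] at this
    omega
  refine ⟨ℕ → Seed L, inferInstance, Measure.infinitePi fun _ => seedMeasure L, inferInstance,
    pastCoding ε s, ⟨measurable_pastCoding, pastCoding_shift, rfl⟩, ?_, ?_⟩
  · rw [ae_iff]
    refine le_antisymm (le_of_forall_le_add_mul_pow ENNReal.one_ne_top hr fun n => ?_) (zero_le)
    rw [zero_add, one_mul]
    refine (measure_mono fun y hy => ?_).trans (htail n)
    have hy' : codingRadius (pastCoding ε s) 0 y = ⊤ := not_not.1 hy
    simp [hy']
  · have hr' : (survivalRate d L ε).toReal < 1 := by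
      simpa using (ENNReal.toReal_lt_toReal hr.ne_top ENNReal.one_ne_top).2 hr
    have hr0 : 0 ≤ (survivalRate d L ε).toReal := ENNReal.toReal_nonneg
    -- A rate strictly above `ρ` is positive, so its logarithm can be used.
    obtain ⟨r, hr1, hr2⟩ := exists_between hr'
    have hrpos : 0 < r := hr0.trans_lt hr1
    have hle : survivalRate d L ε ≤ ENNReal.ofReal r := by
      rw [← ENNReal.ofReal_toReal hr.ne_top]
      exact ENNReal.ofReal_le_ofReal hr1.le
    -- Radius at least `n + 1` only forces survival to depth `n`; the constant `r⁻¹` pays for this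
    -- shift and makes the case `n = 0` trivial.
    refine ⟨r⁻¹, inv_pos.2 hrpos, -Real.log r, by linarith [Real.log_neg hrpos hr2], fun n => ?_⟩
    have hexp : r⁻¹ * Real.exp (- -Real.log r * n) = r⁻¹ * r ^ n := by
      rw [neg_neg, mul_comm (Real.log r), Real.exp_nat_mul, Real.exp_log hrpos]
    rw [hexp]
    cases n with
    | zero =>
      refine prob_le_one.trans ?_
      rw [pow_zero, mul_one, ENNReal.one_le_ofReal]
      exact (one_le_inv₀ hrpos).2 hr2.le
    | succ n =>
      rw [pow_succ, mul_comm, mul_assoc, mul_inv_cancel₀ hrpos.ne', mul_one,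
        ENNReal.ofReal_pow hrpos.le]
      exact (htail n).trans (pow_le_pow_left' hle n)

end

/-! ### Approximation of finitary factors by finitely dependent fields -/

theorem indep_cylinderEvents_infinitePi {ι : Type*} {X : ι → Type*} [∀ i, MeasurableSpace (X i)]
    (μ : ∀ i, Measure (X i)) [∀ i, IsProbabilityMeasure (μ i)] {A B : Set ι}
    (h : Disjoint A B) :
    Indep (cylinderEvents A) (cylinderEvents B) (Measure.infinitePi μ) := by
  have h1 := iIndepFun_infinitePi (P := μ) (X := fun _ x => x) fun _ => measurable_id
  rw [iIndepFun_iff_iIndep] at h1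
  exact indep_iSup_of_disjoint (fun i => (measurable_pi_apply i).comap_le) h1 h

/-- The coding that reads only the coordinates at distance at most `r`, the others being replaced
by the constant `o`. -/
def truncatedCoding {d : ℕ} {S Y : Type*} (F : (Site d → Y) → (Site d → S)) (o : Y) (r : ℕ)
    (y : Site d → Y) : Site d → S := fun i =>
  F (fun j => if latticeDist j i ≤ r then y j else o) i

section
variable {d : ℕ} {S Y : Type*}

theorem truncatedCoding_eq_of_codingRadius_lt {F : (Site d → Y) → (Site d → S)} (o : Y) {r : ℕ}
    {i : Site d} {y : Site d → Y} (h : codingRadius F i y < (r + 1 : ℕ)) :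
    truncatedCoding F o r y i = F y i := by
  simp only [codingRadius, iInf_lt_iff] at h
  obtain ⟨r', hr', hlt⟩ := h
  have hle : r' ≤ r := by
    rw [Nat.cast_lt] at hlt
    omega
  exact (hr' _ fun j hj => if_pos (hj.trans hle)).symm

theorem truncatedCoding_shift {F : (Site d → Y) → (Site d → S)}
    (hF : ∀ (k : Site d) (y : Site d → Y), F (shiftConfig k y) = shiftConfig k (F y))
    (o : Y) (r : ℕ) (k : Site d) (y : Site d → Y) :
    truncatedCoding F o r (shiftConfig k y) = shiftConfig k (truncatedCoding F o r y) := by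
  ext1 i
  change F _ i = F _ (k + i)
  have : (fun j => if latticeDist j i ≤ r then shiftConfig k y j else o) =
      shiftConfig k fun j => if latticeDist j (k + i) ≤ r then y j else o := by
    ext1 j
    simp only [shiftConfig, latticeDist_add_left]
  rw [this, hF]
  rfl

variable [MeasurableSpace S] [MeasurableSpace Y]

theorem measurable_truncatedCoding_apply {F : (Site d → Y) → (Site d → S)} (hF : Measurable F)
    (o : Y) (r : ℕ) {i : Site d} {B : Set (Site d)} (hB : ∀ j, latticeDist j i ≤ r → j ∈ B) :
    Measurable[cylinderEvents B] fun y => truncatedCoding F o r y i := by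
  have h1 : Measurable[cylinderEvents B] fun (y : Site d → Y) (j : Site d) =>
      if latticeDist j i ≤ r then y j else o := by
    rw [@measurable_pi_iff]
    intro j
    by_cases hj : latticeDist j i ≤ r
    · simp only [hj, if_true]
      exact measurable_cylinderEvent_apply (hB j hj)
    · simp only [hj, if_false]
      exact @measurable_const _ _ _ (cylinderEvents _) _
  exact ((measurable_pi_apply i).comp hF).comp h1

theorem measurable_truncatedCoding {F : (Site d → Y) → (Site d → S)} (hF : Measurable F)
    (o : Y) (r : ℕ) : Measurable (truncatedCoding F o r) :=
  measurable_pi_iff.2 fun i => (measurable_truncatedCoding_apply hF o r (i := i) (B := Set.univ)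
    fun _ _ => Set.mem_univ _).mono cylinderEvents_le_pi le_rfl

/-- If `A` and `B` are more than `2r` apart, their `r`-neighbourhoods are disjoint, so the two
restrictions read independent coordinates. -/
theorem isDependentOfRange_map_truncatedCoding (ν : Measure Y) [IsProbabilityMeasure ν]
    {F : (Site d → Y) → (Site d → S)} (hF : Measurable F) (o : Y) {r l : ℕ} (hl : 2 * r ≤ l) :
    IsDependentOfRange l
      ((Measure.infinitePi fun _ : Site d => ν).map (truncatedCoding F o r)) := by
  intro A B hAB
  have hm := measurable_truncatedCoding hF o r
  have hdisj : Disjoint {j : Site d | ∃ a ∈ A, latticeDist j a ≤ r}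
      {j | ∃ b ∈ B, latticeDist j b ≤ r} := by
    refine Set.disjoint_left.2 ?_
    rintro j ⟨a, ha, hja⟩ ⟨b, hb, hjb⟩
    have h1 := hAB a ha b hb
    have h2 := latticeDist_triangle a j b
    rw [latticeDist_comm] at hja
    omega
  have hind := (Indep_iff _ _ _).1
    (indep_cylinderEvents_infinitePi (fun _ : Site d => ν) hdisj)
  have hpre : ∀ (D : Set (Site d)) (t : Set (D → S)), MeasurableSet t →
      MeasurableSet[cylinderEvents {j | ∃ a ∈ D, latticeDist j a ≤ r}]
        (truncatedCoding F o r ⁻¹' (D.domRestrict ⁻¹' t)) := by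
    intro D t ht
    have hD : Measurable[cylinderEvents {j | ∃ a ∈ D, latticeDist j a ≤ r}]
        fun y => D.domRestrict (truncatedCoding F o r y) := by
      rw [@measurable_pi_iff]
      exact fun a => measurable_truncatedCoding_apply hF o r fun j hj => ⟨a, a.2, hj⟩
    exact hD ht
  have hres : ∀ D : Set (Site d), Measurable fun x : Site d → S => D.domRestrict x := fun D =>
    measurable_pi_iff.2 fun i => measurable_pi_apply _
  rw [indepFun_iff_measure_inter_preimage_eq_mul]
  intro t u ht hu
  rw [Measure.map_apply hm ((hres A ht).inter (hres B hu)), Measure.map_apply hm (hres A ht),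
    Measure.map_apply hm (hres B hu)]
  exact hind _ _ (hpre A t ht) (hpre B u hu)

theorem infinitePi_map_shiftConfig (ν : Measure Y) [IsProbabilityMeasure ν] (k : Site d) :
    (Measure.infinitePi fun _ : Site d => ν).map (shiftConfig k) =
      Measure.infinitePi fun _ : Site d => ν := by
  have hm : Measurable (shiftConfig k : (Site d → Y) → _) := by
    unfold shiftConfig
    fun_prop
  refine Measure.eq_infinitePi _ fun s t ht => ?_
  rw [Measure.map_apply hm (.pi s.countable_toSet fun _ _ => ht _)]
  have : (shiftConfig k : (Site d → Y) → _) ⁻¹' (s : Set (Site d)).pi t =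
      ((s.image (k + ·) : Finset (Site d)) : Set (Site d)).pi fun i => t (i - k) := by
    ext y
    simp only [Set.mem_preimage, Set.mem_pi, Finset.mem_coe, Finset.forall_mem_image, shiftConfig,
      add_sub_cancel_left]
  rw [this, Measure.infinitePi_pi _ fun i _ => ht _,
    Finset.prod_image fun i _ j _ h => add_left_cancel h]
  simp

/-! ### Total variation estimates -/

theorem tvDistance_le {X : Type*} [MeasurableSpace X] {μ ν : Measure X} {b : ℝ}
    (h : ∀ A, MeasurableSet A → |μ.real A - ν.real A| ≤ b) : tvDistance μ ν ≤ b := by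
  have : Nonempty {A : Set X // MeasurableSet A} := ⟨⟨∅, MeasurableSet.empty⟩⟩
  exact ciSup_le fun A => h A.1 A.2

theorem tvDistance_le_one {X : Type*} [MeasurableSpace X] (μ ν : Measure X)
    [IsProbabilityMeasure μ] [IsProbabilityMeasure ν] : tvDistance μ ν ≤ 1 := by
  refine tvDistance_le fun A _ => abs_sub_le_iff.2 ⟨?_, ?_⟩
  · linarith [measureReal_le_one (μ := μ) (s := A), measureReal_nonneg (μ := ν) (s := A)]
  · linarith [measureReal_le_one (μ := ν) (s := A), measureReal_nonneg (μ := μ) (s := A)]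

theorem tvDistance_map_le {Ω X : Type*} [MeasurableSpace Ω] [MeasurableSpace X]
    (P : Measure Ω) [IsFiniteMeasure P] {f g : Ω → X} (hf : Measurable f) (hg : Measurable g) :
    tvDistance (P.map f) (P.map g) ≤ P.real {ω | f ω ≠ g ω} := by
  refine tvDistance_le fun A hA => ?_
  rw [map_measureReal_apply hf hA, map_measureReal_apply hg hA]
  have key : ∀ {f g : Ω → X}, P.real (f ⁻¹' A) ≤ P.real (g ⁻¹' A) + P.real {ω | f ω ≠ g ω} := by
    intro f g
    refine (measureReal_mono fun ω hω => ?_).trans (measureReal_union_le _ _)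
    by_cases h : f ω = g ω
    · exact Or.inl (by simpa [h] using hω)
    · exact Or.inr h
  have h1 := key (f := f) (g := g)
  have h2 := key (f := g) (g := f)
  simp only [ne_comm (a := g _)] at h2
  exact abs_sub_le_iff.2 ⟨by linarith, by linarith⟩

/-- For ranges `l` too small for the truncated coding, the product of the one-site marginals is
exact on windows of at most one site. -/
theorem marginal_infinitePi_of_card_le_one (μ : Measure (Site d → S)) [IsProbabilityMeasure μ]
    [∀ i : Site d, IsProbabilityMeasure (μ.map fun x => x i)] {Λ : Finset (Site d)}
    (hΛ : Λ.card ≤ 1) :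
    marginal (Measure.infinitePi fun i : Site d => μ.map fun x => x i) Λ = marginal μ Λ := by
  have hm : Measurable fun x : Site d → S => Λ.restrict x := Finset.measurable_restrict Λ
  refine (Measure.infinitePi_map_restrict _).trans (Measure.pi_eq fun t ht => ?_)
  rw [marginal, Measure.map_apply hm (MeasurableSet.univ_pi ht)]
  rcases Nat.le_one_iff_eq_zero_or_eq_one.1 hΛ with h | h
  · rw [Finset.card_eq_zero] at h
    subst h
    have : (Set.univ.pi t) = Set.univ := Set.eq_univ_of_forall fun x i =>
      (Finset.notMem_empty _ i.2).elim
    rw [this, Set.preimage_univ, measure_univ, Finset.univ_eq_empty, Finset.prod_empty]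
  · obtain ⟨i, rfl⟩ := Finset.card_eq_one.1 h
    have : (Finset.univ : Finset ({i} : Finset (Site d))) = {⟨i, Finset.mem_singleton_self i⟩} := by
      ext ⟨j, hj⟩
      simp only [Finset.mem_univ, Finset.mem_singleton, Subtype.mk.injEq, true_iff]
      exact Finset.mem_singleton.1 hj
    rw [this, Finset.prod_singleton, Measure.map_apply (by fun_prop) (ht _)]
    congr 1
    ext x
    simp only [Set.mem_preimage, Set.mem_univ_pi]
    refine ⟨fun hx => hx ⟨i, Finset.mem_singleton_self i⟩, fun hx j => ?_⟩
    obtain rfl : j = ⟨i, Finset.mem_singleton_self i⟩ :=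
      Subtype.ext (Finset.mem_singleton.1 j.2)
    exact hx

/-- The coding and its truncation are coupled by using the same `y`. They differ at a site only if
the coding radius there exceeds `r`; translation covariance reduces this to the origin, and a union
bound over `Λ` concludes. -/
theorem tvDistance_marginal_truncatedCoding_le (ν : Measure Y) [IsProbabilityMeasure ν]
    {F : (Site d → Y) → (Site d → S)} {μ : Measure (Site d → S)} (hF : IsCoding ν μ F) (o : Y)
    (r : ℕ) {b : ℝ} (hb : 0 ≤ b)
    (h : (Measure.infinitePi fun _ : Site d => ν) {y | ((r + 1 : ℕ) : ℕ∞) ≤ codingRadius F 0 y} ≤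
      ENNReal.ofReal b) (Λ : Finset (Site d)) :
    tvDistance (marginal μ Λ)
      (marginal ((Measure.infinitePi fun _ : Site d => ν).map (truncatedCoding F o r)) Λ) ≤
        Λ.card * b := by
  set P := Measure.infinitePi fun _ : Site d => ν
  have hres : Measurable fun x : Site d → S => Λ.restrict x := Finset.measurable_restrict Λ
  have hm := measurable_truncatedCoding hF.measurable o r
  rw [← hF.map_eq, marginal, marginal, Measure.map_map hres hF.measurable, Measure.map_map hres hm]
  refine (tvDistance_map_le P (hres.comp hF.measurable) (hres.comp hm)).trans ?_
  have hsite : ∀ i : Site d, P.real {y | F y i ≠ truncatedCoding F o r y i} ≤ b := by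
    intro i
    have hms : Measurable (shiftConfig i : (Site d → Y) → _) := by
      unfold shiftConfig
      fun_prop
    refine ENNReal.toReal_le_of_le_ofReal hb (le_trans ?_ h)
    calc P {y | F y i ≠ truncatedCoding F o r y i}
        ≤ P (shiftConfig i ⁻¹' {y | ((r + 1 : ℕ) : ℕ∞) ≤ codingRadius F 0 y}) := by
          refine measure_mono fun y hy => ?_
          by_contra hlt
          have h1 := truncatedCoding_eq_of_codingRadius_lt o (not_le.1 hlt)
          rw [truncatedCoding_shift hF.commutes, hF.commutes] at h1
          simp only [shiftConfig, add_zero] at h1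
          exact hy h1.symm
      -- The coding-radius event is not known to be measurable, so only this inequality is used.
      _ ≤ P.map (shiftConfig i) {y | ((r + 1 : ℕ) : ℕ∞) ≤ codingRadius F 0 y} :=
          Measure.le_map_apply hms.aemeasurable _
      _ = _ := by rw [infinitePi_map_shiftConfig]
  calc P.real {y | ((fun x : Site d → S => Λ.restrict x) ∘ F) y ≠
        ((fun x : Site d → S => Λ.restrict x) ∘ truncatedCoding F o r) y}
      ≤ P.real (⋃ i ∈ Λ, {y | F y i ≠ truncatedCoding F o r y i}) := by
        refine measureReal_mono (fun y hy => ?_) (measure_ne_top _ _)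
        by_contra hn
        simp only [Set.mem_iUnion, not_exists] at hn
        refine hy (funext fun i => ?_)
        exact not_not.1 (hn i i.2)
    _ ≤ ∑ i ∈ Λ, P.real {y | F y i ≠ truncatedCoding F o r y i} := measureReal_biUnion_finset_le _ _
    _ ≤ ∑ i ∈ Λ, b := Finset.sum_le_sum fun i _ => hsite i
    _ = Λ.card * b := by simp

theorem isDependentOfRange_infinitePi (μ : Site d → Measure S) [∀ i, IsProbabilityMeasure (μ i)]
    (l : ℕ) : IsDependentOfRange l (Measure.infinitePi μ) := by
  intro A B hAB
  have hdisj : Disjoint A B := Set.disjoint_left.2 fun a ha hb => by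
    have := hAB a ha a hb
    rw [latticeDist_self] at this
    omega
  rw [IndepFun_iff_Indep]
  exact indep_of_indep_of_le_left (indep_of_indep_of_le_right
    (indep_cylinderEvents_infinitePi μ hdisj) (measurable_restrict_cylinderEvents B).comap_le)
    (measurable_restrict_cylinderEvents A).comap_le

theorem IsFFIIDWithExpTails.exists_finitely_dependent_approx {μ : Measure (Site d → S)}
    [IsProbabilityMeasure μ] (h : IsFFIIDWithExpTails μ) :
    ∃ c : ℝ, 0 < c ∧ ∀ l : ℕ, ∃ ν : Measure (Site d → S),
      IsProbabilityMeasure ν ∧ IsDependentOfRange l ν ∧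
      ∀ Λ : Finset (Site d),
        tvDistance (marginal μ Λ) (marginal ν Λ) ≤ (Λ.card : ℝ) * Real.exp (-c * l) := by
  obtain ⟨Y, _, ν, _, F, hF, -, C, hC, c, hc, htail⟩ := h
  obtain ⟨o⟩ : Nonempty Y := nonempty_of_isProbabilityMeasure ν
  obtain ⟨m, hm⟩ := exists_nat_gt (4 * Real.log C / c)
  have hlog : 0 < Real.log 2 := Real.log_pos one_lt_two
  -- For `l ≥ m` one has `C ≤ exp (c l / 4)`, so half of the decay `exp (-c l / 2)` absorbs `C` and
  -- the rate `c / 4` remains. For `l < m` the second bound ensures `exp (-c' l) ≥ 1 / 2`.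
  set c' := min (c / 4) (Real.log 2 / (m + 1)) with hc'
  have hc'pos : 0 < c' := lt_min (by positivity) (by positivity)
  have hmarg : ∀ (κ : Measure (Site d → S)) [IsProbabilityMeasure κ] (Λ : Finset (Site d)),
      IsProbabilityMeasure (marginal κ Λ) := fun κ _ Λ =>
    Measure.isProbabilityMeasure_map (Finset.measurable_restrict Λ).aemeasurable
  refine ⟨c', hc'pos, fun l => ?_⟩
  by_cases hl : m ≤ l
  · have hm' := measurable_truncatedCoding hF.measurable o (l / 2)
    refine ⟨_, Measure.isProbabilityMeasure_map hm'.aemeasurable,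
      isDependentOfRange_map_truncatedCoding ν hF.measurable o (r := l / 2) (by omega),
      fun Λ => ?_⟩
    refine (tvDistance_marginal_truncatedCoding_le ν hF o (l / 2) (by positivity)
      (htail (l / 2 + 1)) Λ).trans (mul_le_mul_of_nonneg_left ?_ (Nat.cast_nonneg _))
    have h1 : (l : ℝ) / 2 ≤ ((l / 2 + 1 : ℕ) : ℝ) := by
      rw [div_le_iff₀ two_pos]
      exact_mod_cast (by omega : l ≤ (l / 2 + 1) * 2)
    have h2 : Real.log C ≤ c / 4 * l := by
      have : 4 * Real.log C / c < l := hm.trans_le (by exact_mod_cast hl)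
      rw [div_lt_iff₀ hc] at this
      linarith
    have h3 : c' * l ≤ c / 4 * l := mul_le_mul_of_nonneg_right (min_le_left _ _) (Nat.cast_nonneg _)
    have h4 : c * (l / 2) ≤ c * ((l / 2 + 1 : ℕ) : ℝ) := mul_le_mul_of_nonneg_left h1 hc.le
    rw [← Real.exp_log hC, ← Real.exp_add, Real.exp_le_exp]
    linarith
  · have hprob : ∀ i : Site d, IsProbabilityMeasure (μ.map fun x => x i) := fun i =>
      Measure.isProbabilityMeasure_map (measurable_pi_apply i).aemeasurable
    refine ⟨Measure.infinitePi fun i : Site d => μ.map fun x => x i, inferInstance,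
      isDependentOfRange_infinitePi _ l, fun Λ => ?_⟩
    -- With at least two sites the claimed bound is at least `2 * 2⁻¹ = 1`, hence trivial; with at
    -- most one site the marginals agree.
    rcases Nat.lt_or_ge 1 Λ.card with hΛ | hΛ
    · refine (tvDistance_le_one _ _).trans ?_
      have h1 : Real.exp (-Real.log 2) ≤ Real.exp (-c' * l) := by
        rw [Real.exp_le_exp, neg_mul, neg_le_neg_iff]
        have : (l : ℝ) ≤ m + 1 := by exact_mod_cast (by omega : l ≤ m + 1)
        calc c' * l ≤ Real.log 2 / (m + 1) * (m + 1) := by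
              gcongr
              exact min_le_right _ _
          _ = Real.log 2 := by field_simp
      rw [Real.exp_neg, Real.exp_log two_pos] at h1
      have h2 : (2 : ℝ) ≤ Λ.card := by exact_mod_cast hΛ
      calc (1 : ℝ) = 2 * 2⁻¹ := by norm_num
        _ ≤ _ := by gcongr
    · rw [marginal_infinitePi_of_card_le_one μ hΛ]
      refine tvDistance_le fun A _ => ?_
      simp only [sub_self, abs_zero]
      positivity

end

end

theorem theorem2 (d : ℕ) (hd : 1 ≤ d) (L : ℝ) (hL : 0 < L) :
    ∃ ε₀ : ℝ, 0 < ε₀ ∧ ∀ ε : ℝ, |ε| < ε₀ →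
      (∃! μ : Measure (Site d → Set.Icc (-L) L), IsTruncatedGibbs ε L μ) ∧
      ∀ μ : Measure (Site d → Set.Icc (-L) L), IsTruncatedGibbs ε L μ →
        IsFFIIDWithExpTails μ ∧
        ∃ c : ℝ, 0 < c ∧ ∀ l : ℕ, ∃ ν : Measure (Site d → Set.Icc (-L) L),
          IsProbabilityMeasure ν ∧ IsDependentOfRange l ν ∧
          ∀ Λ : Finset (Site d),
            tvDistance (marginal μ Λ) (marginal ν Λ) ≤ (Λ.card : ℝ) * Real.exp (-c * l) := by
  have : Fact (0 < L) := ⟨hL⟩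
  refine ⟨(1 / 2) ^ (2 * d + 1) / ((2 * d + 1) * (2 * L ^ 2)), by positivity, fun ε hε => ?_⟩
  have hr : survivalRate d L ε < 1 := survivalRate_lt_one hL hε
  -- The choice of default spin is immaterial: the uniqueness argument identifies `μ` with the law
  -- of the coding for any `s`.
  let s : Spin L := ⟨0, by constructor <;> linarith⟩
  refine ⟨⟨pastLaw d L ε s, isTruncatedGibbs_pastLaw hr s, fun μ hμ => hμ.eq_pastLaw hr s⟩,
    fun μ hμ => ?_⟩
  have := hμ.isProbabilityMeasure
  have hFF : IsFFIIDWithExpTails μ := by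
    rw [hμ.eq_pastLaw hr s]
    exact isFFIIDWithExpTails_pastLaw hr s
  exact ⟨hFF, hFF.exists_finitely_dependent_approx⟩
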